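/- Let $\mathbb K\in\{\mathbb R,\mathbb C\}$ and let $N\ge 0$ be an integer. For a Lie algebra $\mathfrak g$ over $\mathbb K$ put $\mathfrak g^{(1)}=\mathfrak g$ and $\mathfrak g^{(j)}=[\mathfrak g,\mathfrak g^{(j-1)}]$ (linear span of brackets) for $j\ge 2$, and assume $\mathfrak g^{(N+1)}=\{0\}$ in what follows; this includes every $(N+1)$-step nilpotent Lie algebra, that is, one with $\mathfrak g^{(N)}\neq\{0\}=\mathfrak g^{(N+1)}$, where $N\ge1$. (1) Let $G$ be a connected and simply connected (smooth) Banach–Lie group over $\mathbb K$ whose Lie algebra $\mathfrak g$ satisfies $\mathfrak g^{(N+1)}=\{0\}$. Then there exist a Banach space $F$ over $\mathbb K$ and an injective group homomorphism $\rho$ from $G$ into the invertible bounded operators on $F$ that is continuous for the operator norm and satisfies $$(\rho(x)-\mathbf 1)^{2^{N-1}N+1}=0\quad\text{for all }x\in G.$$ (2) Let $\mathfrak g$ be a Banach–Lie algebra over $\mathbb K$ (a Banach space with a continuous Lie bracket) with $\mathfrak g^{(N+1)}=\{0\}$. Then there exist a Banach space $F$ over $\mathbb K$ and an injective bounded linear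 map $\rho\colon\mathfrak g\to\mathcal B(F)$ into the bounded operators on $F$ with $\rho([x,y])=\rho(x)\rho(y)-\rho(y)\rho(x)$ for all $x,y\in\mathfrak g$ and $$\rho(x)^{2^{N-1}N+1}=0\quad\text{for all }x\in\mathfrak g.$$ (For $N=0$ the exponent $2^{N-1}N+1$ is $1$.) -/

import Mathlib

open scoped Manifold ContDiff

universe u v w

/-- A normed Lie ring: a Lie ring with a norm for which the bracket is bounded. -/
class NormedLieRing (L : Type*) extends NormedAddCommGroup L, LieRing L where
  exists_norm_lie_le : ∃ C : ℝ, ∀ x y : L, ‖⁅x, y⁆‖ ≤ C * ‖x‖ * ‖y‖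

/-- A normed Lie algebra over `𝕜`. Together with `[CompleteSpace L]` this is a Banach-Lie algebra:
a Banach space with a Lie algebra structure whose bracket is continuous. -/
class NormedLieAlgebra (𝕜 : Type*) (L : Type*) [NormedField 𝕜] [NormedLieRing L]
  extends NormedSpace 𝕜 L, LieAlgebra 𝕜 L

/-- Over `ℝ` and `ℂ` a smooth Lie group has the smoothness which Mathlib asks for in the
construction of the Lie bracket on its tangent space at the identity. -/
instance lieGroup_minSmoothness {𝕜 E G : Type*} [RCLike 𝕜] [NormedAddCommGroup E]
    [NormedSpace 𝕜 E] [TopologicalSpace G] [ChartedSpace E G] [Group G]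
    [LieGroup 𝓘(𝕜, E) ∞ G] :
    LieGroup 𝓘(𝕜, E) (minSmoothness 𝕜 3) G :=
  LieGroup.of_le (n := ∞) (by
    rw [minSmoothness_of_isRCLikeNormedField]
    exact ENat.LEInfty.out)

/-!
Regard the linear maps on the enveloping algebra of `𝔤` which vanish on products of more than `N`
elements of `𝔤` as finite sequences of bounded multilinear maps. They form a Banach space, on which
`𝔤` acts by insertion of vectors in the first slot, and `ρ(x) ^ (N + 1) = 0` since every insertion
lowers the degree. The action is faithful: the iterated derivatives at `0` of the identity of `𝔤`
along the left-invariant vector fields in exponential coordinates form an element `ξ` of the space,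
and the image of `ξ` under `exp ρ(x)` has `x` as its constant term. So `exp ρ(x)` has a logarithm,
which is moreover the restriction of a linear map.

For the group, `dP = P · ρ(θ)` with the Maurer-Cartan form `θ` is solved near the identity by the
Poincaré lemma, one step of the filtration by degree at a time. The solution is a local
homomorphism, which extends to a homomorphism `π` on the simply connected group `G`. As `log ∘ π` is
locally injective, the local exponential map of `G` extends dyadically to all of `𝔤`, and it is
a bijection onto `G` because `log ∘ π` inverts it. Hence `π` is injective with values `exp ρ(x)`,
and `exp ρ(x) - 1` is a multiple of `ρ(x)`.
-/

theorem lie_mem_lowerCentralSeries_add {R L : Type*} [CommRing R] [LieRing L] [LieAlgebra R L]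
    {i j : ℕ} {x y : L} (hx : x ∈ LieModule.lowerCentralSeries R L L i)
    (hy : y ∈ LieModule.lowerCentralSeries R L L j) :
    ⁅x, y⁆ ∈ LieModule.lowerCentralSeries R L L (i + j + 1) := by
  have lie_mem_succ {k : ℕ} {z : L} (a : L) (hz : z ∈ LieModule.lowerCentralSeries R L L k) :
      ⁅a, z⁆ ∈ LieModule.lowerCentralSeries R L L (k + 1) := by
    rw [LieModule.lowerCentralSeries_succ]
    exact LieSubmodule.lie_mem_lie (LieSubmodule.mem_top a) hz
  induction i generalizing j x y with
  | zero => simpa using lie_mem_succ x hy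
  | succ i ih =>
    rw [LieModule.lowerCentralSeries_succ, ← LieSubmodule.mem_toSubmodule,
      LieSubmodule.lieIdeal_oper_eq_linear_span'] at hx
    induction hx using Submodule.span_induction with
    | mem z hz =>
      obtain ⟨a, -, b, hb, rfl⟩ := hz
      rw [lie_lie, add_right_comm i 1 j]
      exact sub_mem (lie_mem_succ a (ih hb hy)) (ih hb (lie_mem_succ a hy))
    | zero => simp
    | add a b _ _ ha hb => rw [add_lie]; exact add_mem ha hb
    | smul c a _ ha => rw [smul_lie]; exact Submodule.smul_mem _ c ha

section Finset

open Finset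

variable {M : Type*} [AddCommMonoid M]

theorem sum_antidiagonal_choose_add_two_nsmul (f : ℕ → ℕ → M) (n : ℕ) :
    ∑ p ∈ antidiagonal (n + 1), (n + 3).choose (p.1 + 1) • f p.1 p.2 =
      ∑ p ∈ antidiagonal n, (n + 2).choose (p.1 + 1) • (f (p.1 + 1) p.2 + f p.1 (p.2 + 1)) +
        (f 0 (n + 1) + f (n + 1) 0) := by
  simp only [Nat.choose_succ_succ' (n + 2), add_smul, sum_add_distrib, smul_add]
  rw [Nat.sum_antidiagonal_succ (f := fun p : ℕ × ℕ => (n + 2).choose p.1 • f p.1 p.2),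
    Nat.sum_antidiagonal_succ' (f := fun p : ℕ × ℕ => (n + 2).choose (p.1 + 1) • f p.1 p.2)]
  simp only [Nat.choose_zero_right, Nat.choose_self, one_smul]
  abel

theorem sum_range_sum_antidiagonal_of_eq_zero {f : ℕ → ℕ → M} {n m : ℕ} (hnm : n ≤ m)
    (hf : ∀ i j, n ≤ i + j → f i j = 0) :
    ∑ k ∈ range n, ∑ p ∈ antidiagonal k, f p.1 p.2 = ∑ i ∈ range m, ∑ j ∈ range m, f i j := by
  simp only [Nat.sum_antidiagonal_eq_sum_range_succ]
  rw [sum_range_diag_flip]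
  refine sum_subset_zero_on_sdiff (range_mono hnm) (fun i hi => sum_eq_zero fun j _ => hf i j ?_)
    fun i _ => sum_subset (range_mono (by lia)) fun j _ hj => hf i j ?_
  all_goals simp only [mem_sdiff, mem_range] at *; lia

end Finset

section MaurerCartan

open Filter Topology

variable {𝕜 E V : Type*} [NontriviallyNormedField 𝕜] [NormedAddCommGroup E] [NormedSpace 𝕜 E]
  [NormedAddCommGroup V] [NormedSpace 𝕜 V] {X : E → V →L[𝕜] E} {θ : E → E →L[𝕜] V} {z : E}

theorem fderiv_clm_apply_const (hX : DifferentiableAt 𝕜 X z) (u : E) (a : V) :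
    fderiv 𝕜 (fun y => X y a) z u = fderiv 𝕜 X z u a := by
  rw [(hX.hasFDerivAt.clm_apply (hasFDerivAt_const a z)).fderiv]
  simp

theorem fderiv_coframe_sub_eq_neg_lieBracket (hX : DifferentiableAt 𝕜 X z)
    (hθ : DifferentiableAt 𝕜 θ z) (hθX : ∀ᶠ y in 𝓝 z, ∀ a, θ y (X y a) = a) (a b : V) :
    fderiv 𝕜 θ z (X z a) (X z b) - fderiv 𝕜 θ z (X z b) (X z a) =
      -θ z (VectorField.lieBracket 𝕜 (fun y => X y a) (fun y => X y b) z) := by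
  have fderiv_frame (u : E) (a : V) : fderiv 𝕜 θ z u (X z a) = -θ z (fderiv 𝕜 X z u a) := by
    have hd := hθ.hasFDerivAt.clm_apply (hX.hasFDerivAt.clm_apply (hasFDerivAt_const a z))
    have hconst := hd.congr_of_eventuallyEq (f₁ := fun _ => a) (hθX.mono fun y hy => (hy a).symm)
    have := DFunLike.congr_fun (hconst.unique (hasFDerivAt_const a z)) u
    exact eq_neg_of_add_eq_zero_right (by simpa using this)
  simp only [VectorField.lieBracket, fderiv_clm_apply_const hX, fderiv_frame, map_sub]
  abel

end MaurerCartan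

noncomputable section

/-- A continuous Lie bracket on a normed space with a filtration by subspaces which is
multiplicative for the bracket and vanishes beyond degree `N`. The filtration is indexed as the
lower central series is in the literature, from `filt 1 = ⊤` on. -/
structure NilpotentBracket (𝕜 L : Type*) [RCLike 𝕜] [NormedAddCommGroup L] [NormedSpace 𝕜 L]
    (N : ℕ) where
  br : L →L[𝕜] L →L[𝕜] L
  skew : ∀ x y, br x y = -br y x
  leibniz : ∀ x y z, br x (br y z) = br (br x y) z + br y (br x z)
  filt : ℕ → Submodule 𝕜 L
  filt_one : filt 1 = ⊤
  filt_last : filt (N + 1) = ⊥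
  br_mem : ∀ {i j : ℕ} {x y : L}, x ∈ filt i → y ∈ filt j → br x y ∈ filt (i + j)
  filt_anti : Antitone filt

namespace NilpotentBracket

open Finset.HasAntidiagonal (antidiagonal mem_antidiagonal)

/-- The bracket of a Lie algebra with vanishing lower central series, carried over to a normed
space on which it is continuous. -/
def ofLieAlgebra {𝕜 L 𝔤 : Type*} [RCLike 𝕜] [NormedAddCommGroup L] [NormedSpace 𝕜 L]
    [LieRing 𝔤] [LieAlgebra 𝕜 𝔤] (φ : L ≃ₗ[𝕜] 𝔤) (br : L →L[𝕜] L →L[𝕜] L)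
    (hbr : ∀ x y, φ (br x y) = ⁅φ x, φ y⁆) {N : ℕ}
    (hN : LieModule.lowerCentralSeries 𝕜 𝔤 𝔤 N = ⊥) : NilpotentBracket 𝕜 L N where
  br := br
  skew x y := φ.injective (by rw [map_neg, hbr, hbr, lie_skew])
  leibniz x y z := φ.injective (by simp only [map_add, hbr, leibniz_lie (φ x) (φ y) (φ z)])
  filt i := (LieModule.lowerCentralSeries 𝕜 𝔤 𝔤 (i - 1)).toSubmodule.comap φ.toLinearMap
  filt_one := by simp
  filt_last := by ext x; simp [hN]
  br_mem {i j x y} hx hy := by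
    simp only [Submodule.mem_comap, LinearEquiv.coe_coe, LieSubmodule.mem_toSubmodule] at hx hy ⊢
    rw [hbr]
    exact LieModule.antitone_lowerCentralSeries 𝕜 𝔤 𝔤 (by lia)
      (lie_mem_lowerCentralSeries_add hx hy)
  filt_anti _ _ hij _ hx :=
    LieModule.antitone_lowerCentralSeries 𝕜 𝔤 𝔤 (Nat.sub_le_sub_right hij 1) hx

variable {𝕜 L : Type*} [RCLike 𝕜] [NormedAddCommGroup L] [NormedSpace 𝕜 L] {N : ℕ}
  (B : NilpotentBracket 𝕜 L N)

theorem mem_filt_one (x : L) : x ∈ B.filt 1 := by simp [B.filt_one]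

theorem eq_zero_of_mem_filt {j : ℕ} (hj : N < j) {x : L} (hx : x ∈ B.filt j) : x = 0 := by
  have := B.filt_anti hj hx
  rwa [Nat.succ_eq_add_one, B.filt_last, Submodule.mem_bot] at this

theorem br_self (x : L) : B.br x x = 0 := by
  have := B.skew x x
  rwa [eq_neg_iff_add_eq_zero, ← two_smul 𝕜, smul_eq_zero, or_iff_right two_ne_zero] at this

/-- An operator on `L` which differs from the identity by an operator raising the degree. -/
def IsUnipotent (T : L →L[𝕜] L) : Prop :=
  ∀ (j : ℕ) (v : L), v ∈ B.filt j → v - T v ∈ B.filt (j + 1)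

variable {B} in
theorem IsUnipotent.one_sub_pow_eq_zero {T : L →L[𝕜] L} (hT : B.IsUnipotent T) :
    (1 - T) ^ N = 0 := by
  have one_sub_pow_mem (i : ℕ) (v : L) : ((1 - T) ^ i) v ∈ B.filt (i + 1) := by
    induction i with
    | zero => exact B.mem_filt_one _
    | succ i ih =>
      rw [pow_succ', mul_apply_eq_comp]
      exact hT _ _ ih
  ext v
  exact B.eq_zero_of_mem_filt N.lt_succ_self (one_sub_pow_mem N v)

theorem fderiv_br {f g : L → L} {y : L} (hf : DifferentiableAt 𝕜 f y)
    (hg : DifferentiableAt 𝕜 g y) (u : L) :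
    fderiv 𝕜 (fun z => B.br (f z) (g z)) y u =
      B.br (fderiv 𝕜 f y u) (g y) + B.br (f y) (fderiv 𝕜 g y u) := by
  rw [(B.br.hasFDerivAt_of_bilinear hf.hasFDerivAt hg.hasFDerivAt).fderiv]
  simp [add_comm]

theorem contDiff_br {f g : L → L} {n : WithTop ℕ∞} (hf : ContDiff 𝕜 n f)
    (hg : ContDiff 𝕜 n g) : ContDiff 𝕜 n (fun z => B.br (f z) (g z)) :=
  (B.br.contDiff.comp hf).clm_apply hg

/-- The power `(-ad y) ^ k`. -/
def negAdPow (k : ℕ) (y : L) : L →L[𝕜] L := (-B.br y) ^ k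

@[simp] theorem negAdPow_zero_apply (y v : L) : B.negAdPow 0 y v = v := rfl

theorem negAdPow_succ_apply (k : ℕ) (y v : L) :
    B.negAdPow (k + 1) y v = -B.br y (B.negAdPow k y v) := by
  simp [negAdPow, pow_succ']

theorem contDiff_negAdPow (k : ℕ) {n : WithTop ℕ∞} : ContDiff 𝕜 n (B.negAdPow k) :=
  B.br.contDiff.neg.pow k

theorem differentiableAt_negAdPow_apply (k : ℕ) (v y : L) :
    DifferentiableAt 𝕜 (fun z => B.negAdPow k z v) y :=
  ((B.contDiff_negAdPow k (n := 1)).clm_apply contDiff_const).differentiable one_ne_zero y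

theorem negAdPow_mem (k : ℕ) (y : L) {j : ℕ} {v : L} (hv : v ∈ B.filt j) :
    B.negAdPow k y v ∈ B.filt (k + j) := by
  induction k with
  | zero => simpa using hv
  | succ k ih =>
    rw [negAdPow_succ_apply, Nat.add_comm k 1, Nat.add_assoc]
    exact neg_mem (B.br_mem (B.mem_filt_one y) ih)

theorem fderiv_negAdPow_succ (k : ℕ) (y u v : L) :
    fderiv 𝕜 (fun z => B.negAdPow (k + 1) z v) y u =
      -B.br u (B.negAdPow k y v) - B.br y (fderiv 𝕜 (fun z => B.negAdPow k z v) y u) := by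
  simp only [negAdPow_succ_apply]
  rw [fderiv_fun_neg, neg_apply,
    B.fderiv_br differentiableAt_fun_id (B.differentiableAt_negAdPow_apply k v y)]
  simp [sub_eq_add_neg, add_comm]

theorem br_br_negAdPow (i j : ℕ) (y u v : L) :
    B.br y (B.br (B.negAdPow i y u) (B.negAdPow j y v)) =
      -(B.br (B.negAdPow (i + 1) y u) (B.negAdPow j y v) +
        B.br (B.negAdPow i y u) (B.negAdPow (j + 1) y v)) := by
  rw [B.leibniz, negAdPow_succ_apply, negAdPow_succ_apply, map_neg, map_neg, neg_apply, neg_add,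
    neg_neg, neg_neg]

theorem fderiv_negAdPow_succ_sub (n : ℕ) (y u v : L) :
    fderiv 𝕜 (fun z => B.negAdPow (n + 1) z v) y u -
      fderiv 𝕜 (fun z => B.negAdPow (n + 1) z u) y v =
    -∑ p ∈ antidiagonal n, (n + 2).choose (p.1 + 1) •
      B.br (B.negAdPow p.1 y u) (B.negAdPow p.2 y v) := by
  induction n with
  | zero =>
    simp only [fderiv_negAdPow_succ, negAdPow_zero_apply, fderiv_fun_const, Pi.zero_apply,
      zero_apply, map_zero, B.skew v u]
    simp [two_smul]
    abel
  | succ n ih =>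
    have recursion : fderiv 𝕜 (fun z => B.negAdPow (n + 2) z v) y u -
        fderiv 𝕜 (fun z => B.negAdPow (n + 2) z u) y v =
        -(B.br u (B.negAdPow (n + 1) y v) + B.br (B.negAdPow (n + 1) y u) v) -
          B.br y (fderiv 𝕜 (fun z => B.negAdPow (n + 1) z v) y u -
            fderiv 𝕜 (fun z => B.negAdPow (n + 1) z u) y v) := by
      rw [fderiv_negAdPow_succ B (n + 1) y u, fderiv_negAdPow_succ B (n + 1) y v, map_sub, B.skew v]
      abel
    rw [recursion, ih, sum_antidiagonal_choose_add_two_nsmul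
      fun i j => B.br (B.negAdPow i y u) (B.negAdPow j y v)]
    simp only [map_neg, map_sum, map_nsmul, br_br_negAdPow, smul_neg, Finset.sum_neg_distrib,
      negAdPow_zero_apply]
    abel

/-- The left Maurer–Cartan form in exponential coordinates, `(1 - exp (-ad y)) / ad y`. -/
def mcForm (y : L) : L →L[𝕜] L :=
  ∑ k ∈ Finset.range (N + 1), ((k + 1).factorial : 𝕜)⁻¹ • B.negAdPow k y

theorem mcForm_apply (y v : L) :
    B.mcForm y v = ∑ k ∈ Finset.range (N + 1), ((k + 1).factorial : 𝕜)⁻¹ • B.negAdPow k y v := by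
  simp [mcForm]

theorem contDiff_mcForm {n : WithTop ℕ∞} : ContDiff 𝕜 n B.mcForm := by
  unfold mcForm
  exact ContDiff.sum fun k _ => (B.contDiff_negAdPow k).const_smul _

theorem isUnipotent_mcForm (y : L) : B.IsUnipotent (B.mcForm y) := by
  intro j v hv
  rw [mcForm_apply, Finset.sum_range_succ', zero_add, Nat.factorial_one, Nat.cast_one, inv_one,
    negAdPow_zero_apply, one_smul, sub_add_cancel_right]
  exact neg_mem (Submodule.sum_mem _ fun k _ => Submodule.smul_mem _ _
    (B.filt_anti (by lia) (B.negAdPow_mem (k + 1) y hv)))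

theorem differentiableAt_mcForm (y : L) : DifferentiableAt 𝕜 B.mcForm y :=
  (B.contDiff_mcForm (n := 1)).differentiable one_ne_zero y

theorem fderiv_mcForm (y u v : L) :
    fderiv 𝕜 B.mcForm y u v = ∑ k ∈ Finset.range (N + 1),
      ((k + 1).factorial : 𝕜)⁻¹ • fderiv 𝕜 (fun z => B.negAdPow k z v) y u := by
  rw [← fderiv_clm_apply_const (B.differentiableAt_mcForm y)]
  simp only [mcForm_apply]
  rw [fderiv_fun_sum fun k _ => (B.differentiableAt_negAdPow_apply k v y).fun_const_smul _,
    sum_apply]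
  refine Finset.sum_congr rfl fun k _ => ?_
  rw [fderiv_fun_const_smul (B.differentiableAt_negAdPow_apply k v y), smul_apply]

theorem fderiv_mcForm_sub (y u v : L) :
    fderiv 𝕜 B.mcForm y u v - fderiv 𝕜 B.mcForm y v u = -B.br (B.mcForm y u) (B.mcForm y v) := by
  have br_eq_zero (i j : ℕ) (hij : N ≤ i + j) :
      ((i + 1).factorial : 𝕜)⁻¹ • ((j + 1).factorial : 𝕜)⁻¹ •
        B.br (B.negAdPow i y u) (B.negAdPow j y v) = 0 := by
    rw [B.eq_zero_of_mem_filt (by lia) (B.br_mem (B.negAdPow_mem i y (B.mem_filt_one u))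
      (B.negAdPow_mem j y (B.mem_filt_one v))), smul_zero, smul_zero]
  have term (n : ℕ) : ((n + 1 + 1).factorial : 𝕜)⁻¹ •
      (fderiv 𝕜 (fun z => B.negAdPow (n + 1) z v) y u -
        fderiv 𝕜 (fun z => B.negAdPow (n + 1) z u) y v) =
      -∑ p ∈ antidiagonal n, ((p.1 + 1).factorial : 𝕜)⁻¹ •
        ((p.2 + 1).factorial : 𝕜)⁻¹ • B.br (B.negAdPow p.1 y u) (B.negAdPow p.2 y v) := by
    rw [fderiv_negAdPow_succ_sub, smul_neg, Finset.smul_sum]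
    congr 1
    refine Finset.sum_congr rfl fun p hp => ?_
    obtain rfl : p.1 + p.2 = n := mem_antidiagonal.mp hp
    rw [← Nat.cast_smul_eq_nsmul 𝕜, smul_smul, smul_smul,
      show p.1 + p.2 + 2 = (p.1 + 1) + (p.2 + 1) by ring, Nat.cast_add_choose,
      ← mul_div_assoc, inv_mul_cancel₀ (Nat.cast_ne_zero.mpr (Nat.factorial_ne_zero _)),
      one_div, mul_inv]
  rw [fderiv_mcForm, fderiv_mcForm, ← Finset.sum_sub_distrib]
  simp only [← smul_sub]
  rw [Finset.sum_range_succ', Finset.sum_congr rfl fun n _ => term n, Finset.sum_neg_distrib,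
    sum_range_sum_antidiagonal_of_eq_zero N.le_succ br_eq_zero]
  simp only [negAdPow_zero_apply, fderiv_fun_const, Pi.zero_apply, zero_apply, sub_self, smul_zero,
    add_zero, mcForm_apply, map_sum, sum_apply, map_smul, smul_apply, Finset.smul_sum]
  rw [Finset.sum_comm]
  exact congrArg _ (Finset.sum_congr rfl fun i _ => Finset.sum_congr rfl fun j _ => smul_comm _ _ _)

/-- The left-invariant vector fields in exponential coordinates: `frame y x` is the value at `y` of
the field with value `x` at `0`. As an operator, `frame y` is the inverse of `mcForm y`. -/
def frame (y : L) : L →L[𝕜] L := ∑ i ∈ Finset.range N, (1 - B.mcForm y) ^ i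

theorem mcForm_mul_frame (y : L) : B.mcForm y * B.frame y = 1 := by
  have := mul_neg_geom_sum (1 - B.mcForm y) N
  rwa [(B.isUnipotent_mcForm y).one_sub_pow_eq_zero, sub_zero, sub_sub_cancel] at this

theorem frame_mul_mcForm (y : L) : B.frame y * B.mcForm y = 1 := by
  have := geom_sum_mul_neg (1 - B.mcForm y) N
  rwa [(B.isUnipotent_mcForm y).one_sub_pow_eq_zero, sub_zero, sub_sub_cancel] at this

theorem mcForm_frame (y v : L) : B.mcForm y (B.frame y v) = v :=
  DFunLike.congr_fun (B.mcForm_mul_frame y) v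

theorem frame_mcForm (y v : L) : B.frame y (B.mcForm y v) = v :=
  DFunLike.congr_fun (B.frame_mul_mcForm y) v

theorem contDiff_frame {n : WithTop ℕ∞} : ContDiff 𝕜 n B.frame := by
  unfold frame
  exact ContDiff.sum fun k _ => (contDiff_const.sub B.contDiff_mcForm).pow k

theorem differentiableAt_frame (y : L) : DifferentiableAt 𝕜 B.frame y :=
  (B.contDiff_frame (n := 1)).differentiable one_ne_zero y

theorem frame_smul_self (c : 𝕜) (z : L) : B.frame (c • z) z = z := by
  have negAdPow_eq_zero (k : ℕ) : B.negAdPow (k + 1) (c • z) z = 0 := by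
    rw [negAdPow, pow_succ, mul_apply_eq_comp, neg_apply, map_smul, smul_apply, B.br_self,
      smul_zero, neg_zero, map_zero]
  have mcForm_eq : B.mcForm (c • z) z = z := by
    simp [mcForm_apply, Finset.sum_range_succ', negAdPow_eq_zero]
  simpa only [mcForm_eq] using B.frame_mcForm (c • z) z

theorem lieBracket_frame (y a b : L) :
    VectorField.lieBracket 𝕜 (fun z => B.frame z a) (fun z => B.frame z b) y =
      B.frame y (B.br a b) := by
  have h := fderiv_coframe_sub_eq_neg_lieBracket (B.differentiableAt_frame y)
    (B.differentiableAt_mcForm y) (.of_forall B.mcForm_frame) a b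
  rw [fderiv_mcForm_sub, mcForm_frame, mcForm_frame, neg_inj] at h
  rw [h, frame_mcForm]

/-- Maps built from constants, the identity and the bracket. The index is the total degree of the
constants in each term; it forces the value at `0` into the filtration. -/
inductive IsLiePoly : ℕ → (L → L) → Prop
  | id : IsLiePoly 0 (fun y => y)
  | const {j : ℕ} {x : L} (hx : x ∈ B.filt j) : IsLiePoly j (fun _ => x)
  | br {i j : ℕ} {f g : L → L} (hf : IsLiePoly i f) (hg : IsLiePoly j g) :
      IsLiePoly (i + j) (fun y => B.br (f y) (g y))
  | add {j : ℕ} {f g : L → L} (hf : IsLiePoly j f) (hg : IsLiePoly j g) :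
      IsLiePoly j (fun y => f y + g y)
  | smul {j : ℕ} (c : 𝕜) {f : L → L} (hf : IsLiePoly j f) : IsLiePoly j (fun y => c • f y)

namespace IsLiePoly

variable {B} {i j : ℕ} {f : L → L}

theorem contDiff (hf : B.IsLiePoly j f) {n : WithTop ℕ∞} : ContDiff 𝕜 n f := by
  induction hf with
  | id => exact contDiff_id
  | const => exact contDiff_const
  | br _ _ hf hg => exact B.contDiff_br hf hg
  | add _ _ hf hg => exact hf.add hg
  | smul c _ hf => exact hf.const_smul c

theorem differentiableAt (hf : B.IsLiePoly j f) (y : L) : DifferentiableAt 𝕜 f y :=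
  (hf.contDiff (n := 1)).differentiable one_ne_zero y

theorem apply_zero_mem (hf : B.IsLiePoly j f) : f 0 ∈ B.filt j := by
  induction hf with
  | id => exact zero_mem _
  | const hx => exact hx
  | br _ _ hf hg => exact B.br_mem hf hg
  | add _ _ hf hg => exact add_mem hf hg
  | smul c _ hf => exact Submodule.smul_mem _ c hf

theorem sum {ι : Type*} (s : Finset ι) {f : ι → L → L} (hf : ∀ i ∈ s, B.IsLiePoly j (f i)) :
    B.IsLiePoly j (fun y => ∑ i ∈ s, f i y) := by
  classical
  induction s using Finset.induction_on with
  | empty => simpa using const (zero_mem (B.filt j))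
  | insert a s ha ih =>
    simp only [Finset.sum_insert ha]
    exact (hf a (s.mem_insert_self a)).add (ih fun i hi => hf i (Finset.mem_insert_of_mem hi))

theorem negAdPow (hf : B.IsLiePoly j f) (k : ℕ) :
    B.IsLiePoly j (fun y => B.negAdPow k y (f y)) := by
  induction k with
  | zero => exact hf
  | succ k ih => simpa [negAdPow_succ_apply] using (id.br ih).smul (-1)

theorem mcForm (hf : B.IsLiePoly j f) : B.IsLiePoly j (fun y => B.mcForm y (f y)) := by
  simp only [mcForm_apply]
  exact sum _ fun k _ => (hf.negAdPow k).smul _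

theorem frame (hf : B.IsLiePoly j f) : B.IsLiePoly j (fun y => B.frame y (f y)) := by
  have one_sub_mcForm_pow (k : ℕ) : B.IsLiePoly j (fun y => ((1 - B.mcForm y) ^ k) (f y)) := by
    induction k with
    | zero => exact hf
    | succ k ih => simpa [pow_succ', sub_eq_add_neg] using ih.add (ih.mcForm.smul (-1))
  simp only [NilpotentBracket.frame, sum_apply]
  exact sum _ fun k _ => one_sub_mcForm_pow k

theorem fderiv_frame (hf : B.IsLiePoly i f) {x : L} (hx : x ∈ B.filt j) :
    B.IsLiePoly (i + j) (fun y => fderiv 𝕜 f y (B.frame y x)) := by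
  induction hf with
  | id => simpa using (const hx).frame
  | const => simpa using const (zero_mem (B.filt _))
  | @br i₁ i₂ f g hf hg ihf ihg =>
    simp only [fun y => B.fderiv_br (hf.differentiableAt y) (hg.differentiableAt y)]
    refine add ?_ (by simpa only [add_assoc] using hf.br ihg)
    simpa only [add_right_comm] using ihf.br hg
  | @add i f g hf hg ihf ihg =>
    simpa only [fun y => fderiv_fun_add (hf.differentiableAt y) (hg.differentiableAt y), add_apply]
      using ihf.add ihg
  | @smul i c f hf ih =>
    simpa only [fun y => fderiv_fun_const_smul (hf.differentiableAt y) c, smul_apply]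
      using ih.smul c

end IsLiePoly

/-- Iterated derivatives of the identity along left-invariant vector fields. Their values at `0`
are the values of a linear map from the enveloping algebra to `L` at the products of elements of
`L`. -/
def iterDeriv : List L → L → L
  | [] => fun y => y
  | x :: l => fun y => fderiv 𝕜 (iterDeriv l) y (B.frame y x)

theorem iterDeriv_cons (x : L) (l : List L) (y : L) :
    B.iterDeriv (x :: l) y = fderiv 𝕜 (B.iterDeriv l) y (B.frame y x) := rfl

theorem isLiePoly_iterDeriv (l : List L) : B.IsLiePoly l.length (B.iterDeriv l) := by
  induction l with
  | nil => exact .id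
  | cons x l ih => exact ih.fderiv_frame (B.mem_filt_one x)

theorem iterDeriv_zero_of_length_gt {l : List L} (hl : N < l.length) : B.iterDeriv l 0 = 0 :=
  B.eq_zero_of_mem_filt hl (B.isLiePoly_iterDeriv l).apply_zero_mem

theorem iterDeriv_cons_zero_mem {j : ℕ} {x : L} (hx : x ∈ B.filt j) (l : List L) :
    B.iterDeriv (x :: l) 0 ∈ B.filt (l.length + j) :=
  ((B.isLiePoly_iterDeriv l).fderiv_frame hx).apply_zero_mem

theorem iterDeriv_swap (l₁ l₂ : List L) (a b : L) (y : L) :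
    B.iterDeriv (l₁ ++ a :: b :: l₂) y - B.iterDeriv (l₁ ++ b :: a :: l₂) y =
      B.iterDeriv (l₁ ++ B.br a b :: l₂) y := by
  induction l₁ generalizing y with
  | nil =>
    have frame_apply (c : L) : DifferentiableAt 𝕜 (fun z => B.frame z c) y :=
      (B.differentiableAt_frame y).clm_apply (differentiableAt_const c)
    rw [List.nil_append, List.nil_append, List.nil_append, B.iterDeriv_cons (B.br a b),
      ← B.lieBracket_frame, VectorField.fderiv_apply_lieBracket (n := minSmoothness 𝕜 2)
        (B.isLiePoly_iterDeriv l₂).contDiff.contDiffAt le_rfl (frame_apply b) (frame_apply a)]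
    rfl
  | cons x l ih =>
    have hd (l : List L) := (B.isLiePoly_iterDeriv l).differentiableAt y
    simp only [List.cons_append, iterDeriv_cons, ← funext ih]
    rw [fderiv_fun_sub (hd _) (hd _), sub_apply]

theorem iterDeriv_singleton_smul_self (c : 𝕜) (z : L) : B.iterDeriv [z] (c • z) = z := by
  simpa [iterDeriv] using B.frame_smul_self c z

theorem iterDeriv_cons_smul_self (l : List L) (c : 𝕜) (z : L) :
    B.iterDeriv (z :: l) (c • z) = deriv (fun t : 𝕜 => B.iterDeriv l (t • z)) c := by
  have line : HasDerivAt (fun t : 𝕜 => t • z) z c := by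
    simpa using (hasDerivAt_id c).smul_const z
  rw [iterDeriv_cons, frame_smul_self]
  exact (((B.isLiePoly_iterDeriv l).differentiableAt _).hasFDerivAt.comp_hasDerivAt c
    line).deriv.symm

theorem iterDeriv_replicate_add_two (z : L) (k : ℕ) (c : 𝕜) :
    B.iterDeriv (List.replicate (k + 2) z) (c • z) = 0 := by
  induction k generalizing c with
  | zero =>
    rw [List.replicate_succ, iterDeriv_cons_smul_self, List.replicate_one]
    simp only [iterDeriv_singleton_smul_self, deriv_const']
  | succ k ih =>
    rw [List.replicate_succ, iterDeriv_cons_smul_self]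
    simp only [ih, deriv_const']

/-- The iterated derivatives `iterDeriv`, as a multilinear map in the entries of the list. -/
def iterDerivMultilinear : (k : ℕ) → L → (L [×k]→L[𝕜] L)
  | 0 => fun y => ContinuousMultilinearMap.uncurry0 𝕜 L y
  | k + 1 => fun y =>
    ContinuousLinearMap.uncurryLeft ((fderiv 𝕜 (iterDerivMultilinear k) y).comp (B.frame y))

theorem contDiff_iterDerivMultilinear (k : ℕ) :
    ContDiff 𝕜 ∞ (B.iterDerivMultilinear k) := by
  induction k with
  | zero => exact (continuousMultilinearCurryFin0 𝕜 L L).symm.toContinuousLinearEquiv.contDiff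
  | succ k ih =>
    exact (continuousMultilinearCurryLeftEquiv 𝕜 (fun _ : Fin (k + 1) => L)
      L).symm.toContinuousLinearEquiv.contDiff.comp
        ((ih.fderiv_right (m := ∞) (by simp)).clm_comp B.contDiff_frame)

theorem iterDerivMultilinear_apply (l : List L) (y : L) :
    B.iterDerivMultilinear l.length y l.get = B.iterDeriv l y := by
  induction l generalizing y with
  | nil => rfl
  | cons x l ih =>
    have hd : HasFDerivAt (fun z => B.iterDerivMultilinear l.length z l.get) _ y :=
      (ContinuousMultilinearMap.apply 𝕜 (fun _ : Fin l.length => L) L l.get).hasFDerivAt.comp y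
        ((B.contDiff_iterDerivMultilinear _).differentiable (by simp) y).hasFDerivAt
    rw [iterDeriv_cons, ← funext ih, hd.fderiv]
    rfl

end NilpotentBracket

theorem exp_eq_sum_of_pow_eq_zero (K : Type*) {A : Type*} [Field K] [CharZero K] [Ring A]
    [TopologicalSpace A] [IsTopologicalRing A] [Algebra K A] {a : A} {n : ℕ} (ha : a ^ n = 0) :
    NormedSpace.exp a = ∑ k ∈ Finset.range n, (k.factorial : K)⁻¹ • a ^ k := by
  rw [NormedSpace.exp_eq_tsum K]
  refine tsum_eq_sum fun k hk => ?_
  rw [pow_eq_zero_of_le (not_lt.mp (Finset.mem_range.not.mp hk)) ha, smul_zero]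

/-- Restriction of a family of operators to maps between two subspaces. -/
def restrictFamily {𝕜 L M : Type*} [RCLike 𝕜] [NormedAddCommGroup L] [NormedSpace 𝕜 L]
    [NormedAddCommGroup M] [NormedSpace 𝕜 M] (T : L →L[𝕜] M →L[𝕜] M) (p q : Submodule 𝕜 M)
    (h : ∀ x, ∀ m ∈ p, T x m ∈ q) : L →L[𝕜] p →L[𝕜] q :=
  LinearMap.mkContinuous₂ (LinearMap.mk₂ 𝕜 (fun x (m : p) => (⟨T x m, h x m m.2⟩ : q))
    (by intros; ext; simp) (by intros; ext; simp) (by intros; ext; simp) (by intros; ext; simp))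
    ‖T‖ (fun x m => T.le_opNorm₂ x m)

/-- Sequences of multilinear maps of degree at most `N`. -/
abbrev MultilinearSeq (𝕜 L V : Type*) [RCLike 𝕜] [NormedAddCommGroup L] [NormedSpace 𝕜 L]
    [NormedAddCommGroup V] [NormedSpace 𝕜 V] (N : ℕ) :=
  (k : Fin (N + 1)) → (L [×(k : ℕ)]→L[𝕜] V)

namespace MultilinearSeq

variable {𝕜 L V : Type*} [RCLike 𝕜] [NormedAddCommGroup L] [NormedSpace 𝕜 L]
  [NormedAddCommGroup V] [NormedSpace 𝕜 V] {N : ℕ}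

/-- Evaluation of a sequence of multilinear maps at a word. The value at words longer than `N` is
`0`, as if the sequence were continued by zero. -/
def ev (l : List L) : MultilinearSeq 𝕜 L V N →L[𝕜] V :=
  if h : l.length < N + 1 then
    (ContinuousMultilinearMap.apply 𝕜 (fun _ : Fin l.length => L) V l.get).comp
      (ContinuousLinearMap.proj (R := 𝕜)
        (φ := fun k : Fin (N + 1) => (L [×(k : ℕ)]→L[𝕜] V)) ⟨l.length, h⟩)
  else 0

theorem ev_of_lt {l : List L} (h : l.length < N + 1) (m : MultilinearSeq 𝕜 L V N) :
    ev l m = m ⟨l.length, h⟩ l.get := by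
  simp [ev, h]

theorem ev_of_length_gt {l : List L} (h : N < l.length) (m : MultilinearSeq 𝕜 L V N) :
    ev l m = 0 := by
  simp [ev, h.not_ge]

theorem ext_ev {m m' : MultilinearSeq 𝕜 L V N} (h : ∀ l, ev l m = ev l m') : m = m' := by
  ext ⟨k, hk⟩ v
  obtain ⟨l, rfl, hl⟩ : ∃ (l : List L) (hl : l.length = k), v = l.get ∘ Fin.cast hl.symm :=
    ⟨List.ofFn v, by simp, by ext i; simp⟩
  obtain rfl : v = l.get := hl
  rw [← ev_of_lt, ← ev_of_lt, h]

variable (𝕜 L V N) in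
/-- Insertion of a vector in the first slot. The sign turns the anti-homomorphism, which arises when
words are extended on the left, into a homomorphism of Lie algebras. -/
def shift : L →L[𝕜] MultilinearSeq 𝕜 L V N →L[𝕜] MultilinearSeq 𝕜 L V N :=
  -(∑ k : Fin N,
    (ContinuousLinearMap.compL 𝕜 L _ _
      (ContinuousLinearMap.single 𝕜 (fun k : Fin (N + 1) => (L [×(k : ℕ)]→L[𝕜] V)) k.castSucc)).comp
    ((continuousMultilinearCurryLeftEquiv 𝕜 (fun _ : Fin (k + 1) => L)
      V).toContinuousLinearEquiv.toContinuousLinearMap.comp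
      (ContinuousLinearMap.proj (R := 𝕜)
        (φ := fun k : Fin (N + 1) => (L [×(k : ℕ)]→L[𝕜] V)) k.succ))).flip

theorem shift_apply (x : L) (m : MultilinearSeq 𝕜 L V N) :
    shift 𝕜 L V N x m = -∑ k : Fin N, Pi.single k.castSucc ((m k.succ).curryLeft x) := by
  simp only [shift, neg_apply, ContinuousLinearMap.flip_apply, sum_apply]
  rfl

theorem shift_castSucc (x : L) (m : MultilinearSeq 𝕜 L V N) (k : Fin N) :
    shift 𝕜 L V N x m k.castSucc = -(m k.succ).curryLeft x := by
  rw [shift_apply, Pi.neg_apply, Finset.sum_apply, Finset.sum_eq_single_of_mem k (Finset.mem_univ k)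
    fun i _ hi => Pi.single_eq_of_ne' (Fin.castSucc_injective N |>.ne hi) _, Pi.single_eq_same]

theorem shift_last (x : L) (m : MultilinearSeq 𝕜 L V N) :
    shift 𝕜 L V N x m (Fin.last N) = 0 := by
  rw [shift_apply, Pi.neg_apply, Finset.sum_apply, neg_eq_zero]
  exact Finset.sum_eq_zero fun i _ => Pi.single_eq_of_ne' (Fin.castSucc_ne_last i) _

theorem ev_shift (l : List L) (x : L) (m : MultilinearSeq 𝕜 L V N) :
    ev l (shift 𝕜 L V N x m) = -ev (x :: l) m := by
  rcases lt_trichotomy l.length N with h | h | h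
  · rw [ev_of_lt (by lia), ev_of_lt (by simpa using h)]
    refine (DFunLike.congr_fun (shift_castSucc x m ⟨l.length, h⟩) l.get).trans ?_
    rw [neg_apply, ContinuousMultilinearMap.curryLeft_apply]
    congr 2
    ext i
    refine Fin.cases ?_ (fun j => ?_) i <;> rfl
  · subst h
    rw [ev_of_length_gt (l := x :: l) (by simp), neg_zero, ev_of_lt (by lia)]
    exact DFunLike.congr_fun (shift_last x m) _
  · rw [ev_of_length_gt h, ev_of_length_gt (by simp; lia), neg_zero]

end MultilinearSeq

/-- A representation of a nilpotent bracket by nilpotent operators which preserves a finite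
filtration, together with a linear map which inverts the exponential. -/
structure NilpotentRep {𝕜 L : Type*} [RCLike 𝕜] [NormedAddCommGroup L] [NormedSpace 𝕜 L] {N : ℕ}
    (B : NilpotentBracket 𝕜 L N) (F : Type*) [NormedAddCommGroup F] [NormedSpace 𝕜 F] where
  rep : L →L[𝕜] F →L[𝕜] F
  rep_br : ∀ x y, rep (B.br x y) = rep x * rep y - rep y * rep x
  rep_pow : ∀ x, rep x ^ (N + 1) = 0
  filt : ℕ → Submodule 𝕜 F
  filt_zero : filt 0 = ⊥
  filt_last : filt (N + 1) = ⊤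
  filt_mono : Monotone filt
  rep_mem : ∀ (j : ℕ) (x : L), ∀ m ∈ filt (j + 1), rep x m ∈ filt j
  log : (F →L[𝕜] F) →L[𝕜] L
  log_exp : ∀ x, log (NormedSpace.exp (rep x)) = x
  log_exp_mul : ∀ x, ∃ e : L ≃L[𝕜] L, ∀ y, e y = log (NormedSpace.exp (rep x) * rep y)

namespace NilpotentBracket

open MultilinearSeq

variable {𝕜 L V : Type*} [RCLike 𝕜] [NormedAddCommGroup L] [NormedSpace 𝕜 L]
  [NormedAddCommGroup V] [NormedSpace 𝕜 V] {N : ℕ} (B : NilpotentBracket 𝕜 L N)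

variable (V) in
/-- The sequences of multilinear maps which factor through the enveloping algebra. They are the
linear maps with values in `V` on the enveloping algebra that vanish on products of more than `N`
elements of `L`. -/
def repSpace : Submodule 𝕜 (MultilinearSeq 𝕜 L V N) where
  carrier := {m | ∀ l₁ l₂ a b, ev (l₁ ++ a :: b :: l₂) m - ev (l₁ ++ b :: a :: l₂) m =
    ev (l₁ ++ B.br a b :: l₂) m}
  add_mem' {m m'} hm hm' l₁ l₂ a b := by
    rw [map_add, map_add, map_add, ← hm, ← hm', add_sub_add_comm]
  zero_mem' l₁ l₂ a b := by simp
  smul_mem' c m hm l₁ l₂ a b := by rw [map_smul, map_smul, map_smul, ← hm, smul_sub]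

variable (V) in
theorem isClosed_repSpace : IsClosed (B.repSpace V : Set (MultilinearSeq 𝕜 L V N)) := by
  simp only [repSpace, Submodule.coe_set_mk, AddSubmonoid.coe_set_mk, AddSubsemigroup.coe_set_mk,
    Set.ofPred_forall]
  exact isClosed_iInter fun l₁ => isClosed_iInter fun l₂ => isClosed_iInter fun a =>
    isClosed_iInter fun b => isClosed_eq ((ev _).continuous.sub (ev _).continuous) (ev _).continuous

theorem shift_mem_repSpace (x : L) (m : MultilinearSeq 𝕜 L V N) (hm : m ∈ B.repSpace V) :
    shift 𝕜 L V N x m ∈ B.repSpace V := by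
  intro l₁ l₂ a b
  simp only [ev_shift]
  rw [neg_sub_neg, ← neg_sub]
  exact congrArg _ (hm (x :: l₁) l₂ a b)

variable (V) in
/-- The normed space underlying `repSpace`, as a type of its own. -/
def RepSpace : Type _ := B.repSpace V

instance : NormedAddCommGroup (B.RepSpace V) := inferInstanceAs (NormedAddCommGroup (B.repSpace V))

instance : NormedSpace 𝕜 (B.RepSpace V) := inferInstanceAs (NormedSpace 𝕜 (B.repSpace V))

instance [CompleteSpace V] : CompleteSpace (B.RepSpace V) :=
  (B.isClosed_repSpace V).completeSpace_coe

variable (V) in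
/-- The representation by insertion of vectors. On linear maps on the enveloping algebra, it is the
contragredient of left multiplication. -/
def rep : L →L[𝕜] B.RepSpace V →L[𝕜] B.RepSpace V :=
  restrictFamily (shift 𝕜 L V N) (B.repSpace V) (B.repSpace V) B.shift_mem_repSpace

/-- Evaluation at a word, on the representation space. -/
def evRep (l : List L) : B.RepSpace V →L[𝕜] V :=
  ((ev l).comp (B.repSpace V).subtypeL : B.repSpace V →L[𝕜] V)

theorem evRep_ext {m m' : B.RepSpace V} (h : ∀ l, B.evRep l m = B.evRep l m') : m = m' :=
  Subtype.ext (ext_ev h)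

theorem evRep_rep (l : List L) (x : L) (m : B.RepSpace V) :
    B.evRep l (B.rep V x m) = -B.evRep (x :: l) m :=
  ev_shift l x (Subtype.val (m : B.repSpace V))

theorem evRep_of_length_gt {l : List L} (h : N < l.length) (m : B.RepSpace V) : B.evRep l m = 0 :=
  ev_of_length_gt h _

theorem evRep_rep_pow (l : List L) (x : L) (k : ℕ) (m : B.RepSpace V) :
    B.evRep l ((B.rep V x ^ k) m) = (-1 : 𝕜) ^ k • B.evRep (List.replicate k x ++ l) m := by
  induction k generalizing l with
  | zero => simp
  | succ k ih =>
    rw [pow_succ', mul_apply_eq_comp, evRep_rep, ih, pow_succ, List.replicate_succ']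
    simp

theorem rep_br (x y : L) :
    B.rep V (B.br x y) = B.rep V x * B.rep V y - B.rep V y * B.rep V x := by
  ext1 m
  refine B.evRep_ext fun l => ?_
  rw [sub_apply, map_sub, mul_apply_eq_comp, mul_apply_eq_comp]
  simp only [evRep_rep, neg_neg]
  rw [← neg_sub]
  exact congrArg _ (m.2 [] l x y).symm

theorem rep_pow (x : L) : B.rep V x ^ (N + 1) = 0 := by
  ext1 m
  refine B.evRep_ext fun l => ?_
  rw [evRep_rep_pow, evRep_of_length_gt _ (by simp; lia)]
  simp

variable (V) in
/-- The sequences of degree less than `j`. -/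
def repFilt (j : ℕ) : Submodule 𝕜 (B.RepSpace V) :=
  ⨅ (l : List L) (_ : j ≤ l.length), (B.evRep l).ker

theorem mem_repFilt {j : ℕ} {m : B.RepSpace V} :
    m ∈ B.repFilt V j ↔ ∀ l : List L, j ≤ l.length → B.evRep l m = 0 := by
  simp [repFilt, Submodule.mem_iInf]

/-- The linear map on the enveloping algebra given by the iterated derivatives of the identity at
the origin. -/
def canonicalSeq (ι : L →L[𝕜] V) : MultilinearSeq 𝕜 L V N :=
  fun k => ι.compContinuousMultilinearMap (B.iterDerivMultilinear k 0)

theorem ev_canonicalSeq (ι : L →L[𝕜] V) (l : List L) :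
    ev l (B.canonicalSeq ι) = ι (B.iterDeriv l 0) := by
  rcases lt_or_ge N l.length with hl | hl
  · rw [B.iterDeriv_zero_of_length_gt hl, ev_of_length_gt hl, map_zero]
  · rw [← B.iterDerivMultilinear_apply, ev_of_lt (Nat.lt_succ_of_le hl)]
    rfl

/-- The vector of the representation space given by `canonicalSeq`. -/
def canonicalVector (ι : L →L[𝕜] V) : B.RepSpace V :=
  ⟨B.canonicalSeq ι, fun l₁ l₂ a b => by
    rw [ev_canonicalSeq, ev_canonicalSeq, ev_canonicalSeq, ← B.iterDeriv_swap, map_sub]⟩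

theorem evRep_canonicalVector (ι : L →L[𝕜] V) (l : List L) :
    B.evRep l (B.canonicalVector ι) = ι (B.iterDeriv l 0) :=
  B.ev_canonicalSeq ι l

theorem iterDeriv_singleton_zero (x : L) : B.iterDeriv [x] 0 = x := by
  simpa using B.iterDeriv_singleton_smul_self 0 x

variable (V) in
theorem rep_injective {ι : L →L[𝕜] V} (hι : Function.Injective ι) :
    Function.Injective (B.rep V) := by
  refine (injective_iff_map_eq_zero _).mpr fun x hx => hι ?_
  have evRep_eq : B.evRep [] (B.rep V x (B.canonicalVector ι)) = -ι x := by
    rw [evRep_rep, evRep_canonicalVector, iterDeriv_singleton_zero]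
  rw [hx] at evRep_eq
  simpa using evRep_eq.symm

/-- The coordinate of an operator, read off from the derivative of the identity. -/
def repLog (ι : L ≃L[𝕜] V) : (B.RepSpace V →L[𝕜] B.RepSpace V) →L[𝕜] L :=
  -((ι.symm : V →L[𝕜] L).comp ((B.evRep []).comp
    (ContinuousLinearMap.apply 𝕜 (B.RepSpace V) (B.canonicalVector (ι : L →L[𝕜] V)))))

variable (ι : L ≃L[𝕜] V)

theorem repLog_apply (T : B.RepSpace V →L[𝕜] B.RepSpace V) :
    B.repLog ι T = -ι.symm (B.evRep [] (T (B.canonicalVector (ι : L →L[𝕜] V)))) := rfl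

theorem repLog_rep_pow (x : L) (k : ℕ) :
    B.repLog ι (B.rep V x ^ k) = -((-1 : 𝕜) ^ k • B.iterDeriv (List.replicate k x) 0) := by
  rw [repLog_apply, evRep_rep_pow, List.append_nil, evRep_canonicalVector]
  simp

theorem repLog_rep_pow_mul (x y : L) (k : ℕ) :
    B.repLog ι (B.rep V x ^ k * B.rep V y) =
      (-1 : 𝕜) ^ k • B.iterDeriv (y :: List.replicate k x) 0 := by
  rw [repLog_apply, mul_apply_eq_comp, evRep_rep_pow, List.append_nil, evRep_rep,
    evRep_canonicalVector]
  simp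

theorem repLog_exp (x : L) : B.repLog ι (NormedSpace.exp (B.rep V x)) = x := by
  have replicate_eq_zero (k : ℕ) : B.iterDeriv (List.replicate (k + 1 + 1) x) 0 = 0 := by
    simpa using B.iterDeriv_replicate_add_two x k 0
  rw [exp_eq_sum_of_pow_eq_zero 𝕜 (pow_eq_zero_of_le (Nat.le_succ _) (B.rep_pow x)), map_sum,
    Finset.sum_range_succ', Finset.sum_range_succ']
  have iterDeriv_nil : B.iterDeriv [] 0 = 0 := rfl
  simp only [map_smul, repLog_rep_pow, replicate_eq_zero, zero_add, List.replicate_one,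
    List.replicate_zero, iterDeriv_singleton_zero, iterDeriv_nil]
  simp

theorem isUnipotent_repLog_exp_mul (x : L) :
    B.IsUnipotent ((B.repLog ι).comp ((ContinuousLinearMap.mul 𝕜 _
      (NormedSpace.exp (B.rep V x))).comp (B.rep V))) := by
  intro j y hy
  simp only [ContinuousLinearMap.comp_apply, ContinuousLinearMap.mul_apply']
  rw [exp_eq_sum_of_pow_eq_zero 𝕜 (B.rep_pow x), Finset.sum_mul, map_sum, Finset.sum_range_succ']
  simp only [smul_mul_assoc, map_smul, repLog_rep_pow_mul]
  rw [pow_zero, one_smul, Nat.factorial_zero, Nat.cast_one, inv_one, one_smul, List.replicate_zero,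
    iterDeriv_singleton_zero, sub_add_cancel_right]
  refine neg_mem ((B.filt (j + 1)).sum_mem fun k _ =>
    (B.filt (j + 1)).smul_mem _ ((B.filt (j + 1)).smul_mem _ ?_))
  exact B.filt_anti (by simp) (B.iterDeriv_cons_zero_mem hy (List.replicate (k + 1) x))

theorem repLog_exp_mul (x : L) :
    ∃ e : L ≃L[𝕜] L, ∀ y, e y = B.repLog ι (NormedSpace.exp (B.rep V x) * B.rep V y) := by
  have isNilpotent : IsNilpotent _ := ⟨N, (B.isUnipotent_repLog_exp_mul ι x).one_sub_pow_eq_zero⟩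
  obtain ⟨T, hT⟩ := isNilpotent.isUnit_one_sub
  refine ⟨ContinuousLinearEquiv.unitsEquiv 𝕜 L T, fun y => ?_⟩
  rw [ContinuousLinearEquiv.unitsEquiv_apply, hT, sub_sub_cancel]
  rfl

/-- The representation on linear maps on the enveloping algebra, with the filtration by degree. -/
def nilpotentRep : NilpotentRep B (B.RepSpace V) where
  rep := B.rep V
  rep_br := B.rep_br
  rep_pow := B.rep_pow
  filt := B.repFilt V
  filt_zero := eq_bot_iff.mpr fun m hm => B.evRep_ext fun l => by
    rw [B.mem_repFilt.mp hm l (Nat.zero_le _), map_zero]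
  filt_last := eq_top_iff.mpr fun m _ => B.mem_repFilt.mpr fun l hl => B.evRep_of_length_gt hl m
  filt_mono i j hij m hm := B.mem_repFilt.mpr fun l hl => B.mem_repFilt.mp hm l (hij.trans hl)
  rep_mem j x m hm := B.mem_repFilt.mpr fun l hl => by
    rw [evRep_rep, B.mem_repFilt.mp hm (x :: l) (by simpa using hl), neg_zero]
  log := B.repLog ι
  log_exp := B.repLog_exp ι
  log_exp_mul := B.repLog_exp_mul ι

end NilpotentBracket

section LocalHom

open Topology Filter Bundle

variable {G H : Type*} [TopologicalSpace G] [Group G] [IsTopologicalGroup G] [Group H]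

theorem eventually_nhds_iff_mul_left (x : G) {P : G → Prop} :
    (∀ᶠ y in 𝓝 x, P y) ↔ ∀ᶠ u in 𝓝 1, P (x * u) := by
  rw [← map_mul_left_nhds_one x, eventually_map]

/-- The bundle of germs of extensions of a local homomorphism `f` on `U`. It has discrete fibres,
and its flat sections are the maps `p` with `p (x * u) = p x * f u` for `u` near `1`. -/
@[reducible]
def localHomBundleCore [TopologicalSpace H] [DiscreteTopology H] {U : Set G} (hU : IsOpen U)
    (one_mem : (1 : G) ∈ U) (f : G → H)
    (hf : ∀ a ∈ U, ∀ᶠ u in 𝓝 (1 : G), f (a * u) = f a * f u) : FiberBundleCore G G H where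
  baseSet i := {x | i⁻¹ * x ∈ U}
  isOpen_baseSet i := hU.preimage (continuous_const_mul i⁻¹)
  indexAt x := x
  mem_baseSet_at x := by simpa using one_mem
  coordChange i j x v := v * f (i⁻¹ * x) * (f (j⁻¹ * x))⁻¹
  coordChange_self i x _ v := by simp
  coordChange_comp i j k x _ v := by simp [mul_assoc]
  continuousOn_coordChange i j := by
    rintro ⟨x, v⟩ ⟨⟨hi, hj⟩, -⟩
    have locally_eq : ∀ᶠ y in 𝓝 x,
        f (i⁻¹ * y) * (f (j⁻¹ * y))⁻¹ = f (i⁻¹ * x) * (f (j⁻¹ * x))⁻¹ := by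
      rw [eventually_nhds_iff_mul_left]
      filter_upwards [hf _ hi, hf _ hj] with u hiu hju
      rw [← mul_assoc, ← mul_assoc, hiu, hju]
      group
    have hc : ContinuousAt (fun p : G × H => p.2 * (f (i⁻¹ * x) * (f (j⁻¹ * x))⁻¹)) (x, v) :=
      (continuous_of_discreteTopology (f := fun v : H => v * _)).continuousAt.comp continuousAt_snd
    refine (hc.congr ?_).continuousWithinAt
    filter_upwards [continuousAt_fst.eventually locally_eq] with p hp
    rw [mul_assoc, hp]

theorem exists_eventually_mul_eq_of_local [SimplyConnectedSpace G] [LocallyPathConnectedSpace G]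
    {U : Set G} (hU : IsOpen U) (one_mem : (1 : G) ∈ U) {f : G → H}
    (hf : ∀ a ∈ U, ∀ᶠ u in 𝓝 (1 : G), f (a * u) = f a * f u) :
    ∃ p : G → H, p 1 = 1 ∧ ∀ x, ∀ᶠ u in 𝓝 (1 : G), p (x * u) = p x * f u := by
  let : TopologicalSpace H := ⊥
  have : DiscreteTopology H := ⟨rfl⟩
  have f_one : f 1 = 1 := by simpa using (hf 1 one_mem).self_of_nhds
  let Z := localHomBundleCore hU one_mem f hf
  obtain ⟨s, ⟨s_one, proj_comp⟩, -⟩ := (FiberBundle.isCoveringMap (F := H) (E := Z.Fiber)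
    ).existsUnique_continuousMap_lifts (ContinuousMap.id G) (1 : G)
    (⟨1, (1 : H)⟩ : TotalSpace H Z.Fiber) rfl
  have proj_s (x : G) : (s x).proj = x := congrFun proj_comp x
  let p : G → H := fun x => (s x).snd
  have localTriv_s (x y : G) : ((Z.localTriv x) (s y)).2 = p y * (f (x⁻¹ * y))⁻¹ := by
    rw [Z.localTriv_apply]
    change p y * f ((s y).proj⁻¹ * (s y).proj) * (f (x⁻¹ * (s y).proj))⁻¹ = _
    rw [inv_mul_cancel, f_one, mul_one, proj_s]
  refine ⟨p, by change (s 1).snd = (1 : H); rw [s_one], fun x => ?_⟩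
  have hc : ContinuousAt (fun y => ((Z.localTriv x) (s y)).2) x := by
    have mem_source : s x ∈ (Z.localTriv x).source := by
      rw [Z.mem_localTriv_source, proj_s]
      exact Z.mem_baseSet_at x
    exact (((Z.localTriv x).continuousOn.continuousAt
      ((Z.localTriv x).open_source.mem_nhds mem_source)).comp s.continuous.continuousAt).snd
  simp only [ContinuousAt, localTriv_s, nhds_discrete, tendsto_pure, inv_mul_cancel, f_one, inv_one,
    mul_one] at hc
  filter_upwards [(eventually_nhds_iff_mul_left x).mp hc] with u hu
  rwa [inv_mul_cancel_left, mul_inv_eq_iff_eq_mul] at hu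

theorem map_mul_of_eventually_mul_eq [PreconnectedSpace G] {f p : G → H} (p_one : p 1 = 1)
    (hp : ∀ x, ∀ᶠ u in 𝓝 (1 : G), p (x * u) = p x * f u) (g h : G) : p (g * h) = p g * p h := by
  have isLocallyConstant : IsLocallyConstant fun h => p (g * h) * (p h)⁻¹ := by
    refine (IsLocallyConstant.iff_eventually_eq _).mpr fun h => ?_
    rw [eventually_nhds_iff_mul_left]
    filter_upwards [hp (g * h), hp h] with u hgu hu
    rw [← mul_assoc, hgu, hu]
    group
  have := isLocallyConstant.apply_eq_of_preconnectedSpace h 1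
  rw [mul_one, p_one, inv_one, mul_one] at this
  exact mul_inv_eq_iff_eq_mul.mp this

theorem exists_monoidHom_of_local [SimplyConnectedSpace G] [LocallyPathConnectedSpace G]
    {U : Set G} (hU : IsOpen U) (one_mem : (1 : G) ∈ U) {f : G → H}
    (hf : ∀ a ∈ U, ∀ᶠ u in 𝓝 (1 : G), f (a * u) = f a * f u) :
    ∃ φ : G →* H, ∀ᶠ u in 𝓝 (1 : G), φ u = f u := by
  obtain ⟨p, p_one, hp⟩ := exists_eventually_mul_eq_of_local hU one_mem hf
  exact ⟨⟨⟨p, p_one⟩, map_mul_of_eventually_mul_eq p_one hp⟩, by simpa [p_one] using hp 1⟩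

theorem exists_monoidHom_of_local_isUnit [SimplyConnectedSpace G] [LocallyPathConnectedSpace G]
    {M : Type*} [Monoid M] {U : Set G} (hU : IsOpen U) (one_mem : (1 : G) ∈ U) {f : G → M}
    (isUnit : ∀ a ∈ U, IsUnit (f a))
    (hf : ∀ a ∈ U, ∀ᶠ u in 𝓝 (1 : G), f (a * u) = f a * f u) :
    ∃ φ : G →* M, ∀ᶠ u in 𝓝 (1 : G), φ u = f u := by
  classical
  let fUnit (a : G) : Mˣ := if h : IsUnit (f a) then h.unit else 1
  have coe_fUnit {a : G} (ha : a ∈ U) : (fUnit a : M) = f a := by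
    simp only [fUnit, dif_pos (isUnit a ha), IsUnit.unit_spec]
  have fUnit_mul : ∀ a ∈ U, ∀ᶠ u in 𝓝 (1 : G), fUnit (a * u) = fUnit a * fUnit u := by
    intro a ha
    have mul_mem : ∀ᶠ u in 𝓝 (1 : G), a * u ∈ U :=
      (continuous_const_mul a).continuousAt (hU.mem_nhds (by rwa [mul_one]))
    filter_upwards [hf a ha, hU.mem_nhds one_mem, mul_mem] with u f_mul hu hau
    ext1
    rw [Units.val_mul, coe_fUnit ha, coe_fUnit hu, coe_fUnit hau, f_mul]
  obtain ⟨φ, hφ⟩ := exists_monoidHom_of_local hU one_mem fUnit_mul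
  refine ⟨(Units.coeHom M).comp φ, ?_⟩
  filter_upwards [hφ, hU.mem_nhds one_mem] with u φ_u hu
  exact (congrArg Units.val φ_u).trans (coe_fUnit hu)

end LocalHom

section Flat

open Metric

variable {𝕜 E L F : Type*} [RCLike 𝕜] [NormedAddCommGroup E] [NormedSpace 𝕜 E]
  [NormedAddCommGroup L] [NormedSpace 𝕜 L] [NormedAddCommGroup F] [NormedSpace 𝕜 F]
  {e : E} {r : ℝ}

theorem exists_primitive_ball [CompleteSpace F] (c : F) {α : E → E →L[𝕜] F}
    (hα : ∀ z ∈ ball e r, ∃ α' : E →L[𝕜] E →L[𝕜] F, HasFDerivAt α α' z ∧ ∀ u v, α' u v = α' v u) :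
    ∃ f : E → F, f e = c ∧ ∀ z ∈ ball e r, HasFDerivAt f (α z) z := by
  let : NormedSpace ℝ E := .restrictScalars ℝ 𝕜 E
  let : NormedSpace ℝ F := .restrictScalars ℝ 𝕜 F
  choose! α' hα' hsymm using hα
  obtain ⟨f, hf⟩ := (convex_ball e r).exists_forall_hasFDerivWithinAt_of_hasFDerivWithinAt_symmetric
    (fun z hz => ((hα' z hz).restrictScalars ℝ).hasFDerivWithinAt)
    (fun z hz u _ v _ => hsymm z hz u v)
  refine ⟨fun z => f z + (c - f e), by simp, fun z hz => ?_⟩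
  exact ((hf z hz).hasFDerivAt (isOpen_ball.mem_nhds hz)).add_const _

theorem eqOn_ball_of_hasFDerivAt {f g : E → F} {f' : E → E →L[𝕜] F}
    (hf : ∀ z ∈ ball e r, HasFDerivAt f (f' z) z) (hg : ∀ z ∈ ball e r, HasFDerivAt g (f' z) z)
    (hfg : f e = g e) : Set.EqOn f g (ball e r) := by
  let : NormedSpace ℝ E := .restrictScalars ℝ 𝕜 E
  rcases le_or_gt r 0 with hr | hr
  · rw [ball_eq_empty.2 hr]
    exact Set.eqOn_empty _ _
  · exact isOpen_ball.eqOn_of_fderiv_eq (𝕜 := 𝕜) (convex_ball e r).isPreconnected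
      (fun z hz => (hf z hz).differentiableAt.differentiableWithinAt)
      (fun z hz => (hg z hz).differentiableAt.differentiableWithinAt)
      (fun z hz => by rw [(hf z hz).fderiv, (hg z hz).fderiv]) (mem_ball_self hr) hfg

namespace NilpotentRep

variable {N : ℕ} {B : NilpotentBracket 𝕜 L N} (R : NilpotentRep B F)

theorem rep_mem_self (j : ℕ) (x : L) (m : F) (hm : m ∈ R.filt j) : R.rep x m ∈ R.filt j :=
  R.rep_mem j x m (R.filt_mono (Nat.le_succ j) hm)

/-- The form `P · ρ(θ)` for an operator `P` on a step of the filtration. -/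
def mulRep (j : ℕ) (P : R.filt j →L[𝕜] F) (θ : E →L[𝕜] L) : E →L[𝕜] R.filt j →L[𝕜] F :=
  (ContinuousLinearMap.compL 𝕜 (R.filt j) (R.filt j) F P).comp
    ((restrictFamily R.rep _ _ (R.rep_mem_self j)).comp θ)

/-- The form `P · ρ(θ)`, on the step of the filtration after the one where `P` is defined. -/
def mulRepSucc (j : ℕ) (P : R.filt j →L[𝕜] F) (θ : E →L[𝕜] L) :
    E →L[𝕜] R.filt (j + 1) →L[𝕜] F :=
  (ContinuousLinearMap.compL 𝕜 (R.filt (j + 1)) (R.filt j) F P).comp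
    ((restrictFamily R.rep _ _ (R.rep_mem j)).comp θ)

/-- The inclusion of a step of the filtration into the next one. -/
def filtInclusion (j : ℕ) : R.filt j →L[𝕜] R.filt (j + 1) :=
  (R.filt j).subtypeL.codRestrict _ fun m => R.filt_mono (Nat.le_succ j) m.2

theorem exists_hasFDerivAt_mulRepSucc_symmetric {j : ℕ} {P : E → R.filt j →L[𝕜] F}
    {θ : E → E →L[𝕜] L} {z : E} (hP : HasFDerivAt P (R.mulRep j (P z) (θ z)) z)
    (hθ : DifferentiableAt 𝕜 θ z)
    (hmc : ∀ u v, fderiv 𝕜 θ z u v - fderiv 𝕜 θ z v u = -B.br (θ z u) (θ z v)) :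
    ∃ α' : E →L[𝕜] E →L[𝕜] R.filt (j + 1) →L[𝕜] F,
      HasFDerivAt (fun y => R.mulRepSucc j (P y) (θ y)) α' z ∧ ∀ u v, α' u v = α' v u := by
  refine ⟨_, ((ContinuousLinearMap.compL 𝕜 (R.filt (j + 1)) (R.filt j) F).hasFDerivAt.comp z
    hP).clm_comp ((hasFDerivAt_const _ z).clm_comp hθ.hasFDerivAt), fun u v => ?_⟩
  have rep_fderiv (m : F) : R.rep (fderiv 𝕜 θ z u v) m = R.rep (fderiv 𝕜 θ z v u) m -
      (R.rep (θ z u) (R.rep (θ z v) m) - R.rep (θ z v) (R.rep (θ z u) m)) := by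
    have rep_br := DFunLike.congr_fun (R.rep_br (θ z u) (θ z v)) m
    rw [← neg_eq_iff_eq_neg.mpr (hmc u v), map_neg, map_sub, neg_sub] at rep_br
    simp only [sub_apply, mul_apply_eq_comp] at rep_br
    rw [← rep_br, sub_sub_cancel]
  ext m
  simp only [ContinuousLinearMap.comp_zero, add_zero, add_apply, ContinuousLinearMap.coe_comp,
    Function.comp_apply, ContinuousLinearMap.compL_apply, ContinuousLinearMap.flip_apply, mulRep]
  rw [← map_add, ← map_add]
  congr 1
  ext
  change R.rep (fderiv 𝕜 θ z u v) m + R.rep (θ z u) (R.rep (θ z v) m) =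
    R.rep (fderiv 𝕜 θ z v u) m + R.rep (θ z v) (R.rep (θ z u) m)
  rw [rep_fderiv]
  abel

theorem mulRep_succ_of_comp_inclusion {j : ℕ} {P : R.filt j →L[𝕜] F} {Q : R.filt (j + 1) →L[𝕜] F}
    (hQP : Q.comp (R.filtInclusion j) = P) (θ : E →L[𝕜] L) :
    R.mulRep (j + 1) Q θ = R.mulRepSucc j P θ := by
  subst hQP
  rfl

theorem exists_flat_filt [CompleteSpace F] {θ : E → E →L[𝕜] L}
    (hθ : ∀ z ∈ ball e r, DifferentiableAt 𝕜 θ z)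
    (hmc : ∀ z ∈ ball e r, ∀ u v,
      fderiv 𝕜 θ z u v - fderiv 𝕜 θ z v u = -B.br (θ z u) (θ z v)) (j : ℕ) :
    ∃ P : E → R.filt j →L[𝕜] F, P e = (R.filt j).subtypeL ∧
      ∀ z ∈ ball e r, HasFDerivAt P (R.mulRep j (P z) (θ z)) z := by
  induction j with
  | zero =>
    have : Subsingleton (R.filt 0) := by rw [R.filt_zero]; infer_instance
    exact ⟨fun _ => (R.filt 0).subtypeL, rfl, fun z _ =>
      (hasFDerivAt_const _ z).congr_fderiv (Subsingleton.elim _ _)⟩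
  | succ j ih =>
    obtain ⟨P, P_center, hP⟩ := ih
    obtain ⟨Q, Q_center, hQ⟩ := exists_primitive_ball (R.filt (j + 1)).subtypeL fun z hz =>
      R.exists_hasFDerivAt_mulRepSucc_symmetric (hP z hz) (hθ z hz) (hmc z hz)
    have hasFDerivAt_Q_inclusion (z : E) (hz : z ∈ ball e r) :
        HasFDerivAt (fun z => (Q z).comp (R.filtInclusion j)) (R.mulRep j (P z) (θ z)) z :=
      ((ContinuousLinearMap.compL 𝕜 (R.filt j) (R.filt (j + 1)) F).flip
        (R.filtInclusion j)).hasFDerivAt.comp z (hQ z hz)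
    have Q_inclusion : Set.EqOn (fun z => (Q z).comp (R.filtInclusion j)) P (ball e r) :=
      eqOn_ball_of_hasFDerivAt hasFDerivAt_Q_inclusion hP (by simp only [Q_center, P_center]; rfl)
    exact ⟨Q, Q_center, fun z hz =>
      (hQ z hz).congr_fderiv (R.mulRep_succ_of_comp_inclusion (Q_inclusion hz) (θ z)).symm⟩

theorem exists_flat [CompleteSpace F] {θ : E → E →L[𝕜] L}
    (hθ : ∀ z ∈ ball e r, DifferentiableAt 𝕜 θ z)
    (hmc : ∀ z ∈ ball e r, ∀ u v,
      fderiv 𝕜 θ z u v - fderiv 𝕜 θ z v u = -B.br (θ z u) (θ z v)) :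
    ∃ P : E → F →L[𝕜] F, P e = 1 ∧ ∀ z ∈ ball e r,
      HasFDerivAt P ((ContinuousLinearMap.mul 𝕜 (F →L[𝕜] F) (P z)).comp (R.rep.comp (θ z))) z := by
  obtain ⟨P, P_center, hP⟩ := R.exists_flat_filt hθ hmc (N + 1)
  let ι : F →L[𝕜] R.filt (N + 1) :=
    (ContinuousLinearMap.id 𝕜 F).codRestrict _ fun m => by simp [R.filt_last]
  exact ⟨fun z => (P z).comp ι, by simp only [P_center]; rfl, fun z hz =>
    ((ContinuousLinearMap.compL 𝕜 F (R.filt (N + 1)) F).flip ι).hasFDerivAt.comp z (hP z hz)⟩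

end NilpotentRep

end Flat

end

noncomputable section LieGroupChart

open Topology Filter VectorField

theorem mlieBracket_eq_lieBracket {𝕜 E : Type*} [NontriviallyNormedField 𝕜]
    [NormedAddCommGroup E] [NormedSpace 𝕜 E] (V W : (z : E) → TangentSpace 𝓘(𝕜, E) z) :
    mlieBracket 𝓘(𝕜, E) V W = lieBracket 𝕜 V W := by
  ext1 z
  rw [← mlieBracketWithin_univ, mlieBracketWithin_eq_lieBracketWithin]
  exact congrFun (lieBracketWithin_univ (𝕜 := 𝕜) (V := V) (W := W)) z

section Definitions

variable (𝕜 E G : Type*) [RCLike 𝕜] [NormedAddCommGroup E] [NormedSpace 𝕜 E]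
  [TopologicalSpace G] [ChartedSpace E G] [Group G]

/-- The preferred chart at the identity. -/
abbrev oneChart : PartialEquiv G E := extChartAt 𝓘(𝕜, E) (1 : G)

variable {E}

/-- The multiplication in the chart at the identity. -/
def chartMul (z w : E) : E := oneChart 𝕜 E G ((oneChart 𝕜 E G).symm z * (oneChart 𝕜 E G).symm w)

/-- The frame of left-invariant vector fields, in the chart at the identity: the value at `z` of the
field which is `a` at the identity is `chartFrame 𝕜 G z a`. -/
def chartFrame (z : E) : E →L[𝕜] E := fderiv 𝕜 (chartMul 𝕜 G z) (oneChart 𝕜 E G 1)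

/-- The Maurer-Cartan form in the chart at the identity. It has the junk value `0` where the
frame is not invertible. -/
def chartForm (z : E) : E →L[𝕜] E := Ring.inverse (chartFrame 𝕜 G z)

variable (E)

/-- The bracket of the Lie algebra in the chart at the identity. -/
def chartBr : E →L[𝕜] E →L[𝕜] E :=
  fderiv 𝕜 (chartFrame 𝕜 G) (oneChart 𝕜 E G 1) -
    (fderiv 𝕜 (chartFrame 𝕜 G) (oneChart 𝕜 E G 1)).flip

theorem oneChart_one_mem_target : oneChart 𝕜 E G 1 ∈ (oneChart 𝕜 E G).target :=
  mem_extChartAt_target (I := 𝓘(𝕜, E)) (1 : G)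

theorem oneChart_symm_apply_one : (oneChart 𝕜 E G).symm (oneChart 𝕜 E G 1) = 1 :=
  extChartAt_to_inv (I := 𝓘(𝕜, E)) (1 : G)

theorem continuousAt_oneChart : ContinuousAt (oneChart 𝕜 E G) 1 :=
  continuousAt_extChartAt (I := 𝓘(𝕜, E)) (1 : G)

theorem tendsto_oneChart_symm :
    Tendsto (oneChart 𝕜 E G).symm (𝓝 (oneChart 𝕜 E G 1)) (𝓝 1) := by
  have := continuousAt_extChartAt_symm (I := 𝓘(𝕜, E)) (1 : G)
  rwa [ContinuousAt, oneChart_symm_apply_one] at this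

variable {E}

theorem chartFrame_one : chartFrame 𝕜 G (oneChart 𝕜 E G 1) = 1 := by
  have chartMul_one_left : chartMul 𝕜 G (oneChart 𝕜 E G 1) =ᶠ[𝓝 (oneChart 𝕜 E G 1)] id := by
    filter_upwards [extChartAt_target_mem_nhds (I := 𝓘(𝕜, E)) (1 : G)] with w hw
    rw [chartMul, oneChart_symm_apply_one, one_mul]
    exact (oneChart 𝕜 E G).right_inv hw
  rw [chartFrame, chartMul_one_left.fderiv_eq, fderiv_id]
  rfl

theorem isUnit_chartFrame_one : IsUnit (chartFrame 𝕜 G (oneChart 𝕜 E G 1)) := by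
  rw [chartFrame_one]
  exact isUnit_one

theorem chartForm_one : chartForm 𝕜 G (oneChart 𝕜 E G 1) = 1 := by
  rw [chartForm, chartFrame_one, Ring.inverse_one]

end Definitions

variable {𝕜 E G : Type*} [RCLike 𝕜] [NormedAddCommGroup E] [NormedSpace 𝕜 E]
  [TopologicalSpace G] [ChartedSpace E G] [Group G] {z w : E}

theorem oneChart_target_mem_nhds (hz : z ∈ (oneChart 𝕜 E G).target) :
    (oneChart 𝕜 E G).target ∈ 𝓝 z :=
  (isOpen_extChartAt_target (I := 𝓘(𝕜, E)) (1 : G)).mem_nhds hz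

theorem chartMul_apply_one (hz : z ∈ (oneChart 𝕜 E G).target) :
    chartMul 𝕜 G z (oneChart 𝕜 E G 1) = z := by
  rw [chartMul, oneChart_symm_apply_one, mul_one]
  exact (oneChart 𝕜 E G).right_inv hz

theorem mul_one_mem_source (hz : z ∈ (oneChart 𝕜 E G).target) :
    (oneChart 𝕜 E G).symm z * (oneChart 𝕜 E G).symm (oneChart 𝕜 E G 1) ∈
      (oneChart 𝕜 E G).source := by
  rw [oneChart_symm_apply_one, mul_one]
  exact (oneChart 𝕜 E G).map_target hz

theorem eventually_mul_mem_source [ContinuousMul G] (hz : z ∈ (oneChart 𝕜 E G).target) :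
    ∀ᶠ w in 𝓝 (oneChart 𝕜 E G 1),
      (oneChart 𝕜 E G).symm z * (oneChart 𝕜 E G).symm w ∈ (oneChart 𝕜 E G).source := by
  have tendsto_mul := (tendsto_oneChart_symm 𝕜 E G).const_mul ((oneChart 𝕜 E G).symm z)
  rw [mul_one] at tendsto_mul
  exact tendsto_mul ((isOpen_extChartAt_source (I := 𝓘(𝕜, E)) (1 : G)).mem_nhds
    ((oneChart 𝕜 E G).map_target hz))

theorem oneChart_symm_chartMul
    (hzw : (oneChart 𝕜 E G).symm z * (oneChart 𝕜 E G).symm w ∈ (oneChart 𝕜 E G).source) :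
    (oneChart 𝕜 E G).symm (chartMul 𝕜 G z w) =
      (oneChart 𝕜 E G).symm z * (oneChart 𝕜 E G).symm w :=
  (oneChart 𝕜 E G).left_inv hzw

theorem chartForm_chartFrame (hu : IsUnit (chartFrame 𝕜 G z)) (a : E) :
    chartForm 𝕜 G z (chartFrame 𝕜 G z a) = a :=
  DFunLike.congr_fun (Ring.inverse_mul_cancel _ hu) a

theorem chartFrame_chartForm (hu : IsUnit (chartFrame 𝕜 G z)) (a : E) :
    chartFrame 𝕜 G z (chartForm 𝕜 G z a) = a :=
  DFunLike.congr_fun (Ring.mul_inverse_cancel _ hu) a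

section Smooth

variable [LieGroup 𝓘(𝕜, E) ∞ G]

theorem contMDiffAt_oneChart_symm (hz : z ∈ (oneChart 𝕜 E G).target) :
    ContMDiffAt 𝓘(𝕜, E) 𝓘(𝕜, E) ∞ (oneChart 𝕜 E G).symm z :=
  (contMDiffOn_extChartAt_symm (I := 𝓘(𝕜, E)) (n := ∞) (1 : G)).contMDiffAt
    (oneChart_target_mem_nhds hz)

theorem hasMFDerivAt_oneChart_symm (hz : z ∈ (oneChart 𝕜 E G).target) :
    HasMFDerivAt 𝓘(𝕜, E) 𝓘(𝕜, E) (oneChart 𝕜 E G).symm z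
      (mfderiv 𝓘(𝕜, E) 𝓘(𝕜, E) (oneChart 𝕜 E G).symm z) :=
  ((contMDiffAt_oneChart_symm hz).mdifferentiableAt (by simp)).hasMFDerivAt

theorem contDiffAt_chartMul (hz : z ∈ (oneChart 𝕜 E G).target) (hw : w ∈ (oneChart 𝕜 E G).target)
    (hzw : (oneChart 𝕜 E G).symm z * (oneChart 𝕜 E G).symm w ∈ (oneChart 𝕜 E G).source) :
    ContDiffAt 𝕜 ∞ (Function.uncurry (chartMul 𝕜 G)) (z, w) := by
  rw [← contMDiffAt_iff_contDiffAt]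
  have contMDiffAt_fst : ContMDiffAt 𝓘(𝕜, E × E) 𝓘(𝕜, E) ∞
      (fun p : E × E => (oneChart 𝕜 E G).symm p.1) (z, w) :=
    (contMDiffAt_oneChart_symm hz).comp (z, w) contDiff_fst.contMDiff.contMDiffAt
  have contMDiffAt_snd : ContMDiffAt 𝓘(𝕜, E × E) 𝓘(𝕜, E) ∞
      (fun p : E × E => (oneChart 𝕜 E G).symm p.2) (z, w) :=
    (contMDiffAt_oneChart_symm hw).comp (z, w) contDiff_snd.contMDiff.contMDiffAt
  rw [extChartAt_source] at hzw
  exact (contMDiffAt_extChartAt' (I := 𝓘(𝕜, E)) (n := ∞) hzw).comp (z, w)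
    (contMDiffAt_fst.mul contMDiffAt_snd)

theorem differentiableAt_chartMul (hz : z ∈ (oneChart 𝕜 E G).target)
    (hw : w ∈ (oneChart 𝕜 E G).target)
    (hzw : (oneChart 𝕜 E G).symm z * (oneChart 𝕜 E G).symm w ∈ (oneChart 𝕜 E G).source) :
    DifferentiableAt 𝕜 (chartMul 𝕜 G z) w :=
  ((contDiffAt_chartMul hz hw hzw).comp w (f := fun w => (z, w))
    (contDiffAt_const.prodMk contDiffAt_id)).differentiableAt (by simp)

theorem contDiffAt_chartFrame (hz : z ∈ (oneChart 𝕜 E G).target) :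
    ContDiffAt 𝕜 ∞ (chartFrame 𝕜 G) z :=
  (contDiffAt_chartMul hz (oneChart_one_mem_target 𝕜 E G) (mul_one_mem_source hz)).fderiv
    contDiffAt_const (by simp)

theorem differentiableAt_chartFrame (hz : z ∈ (oneChart 𝕜 E G).target) :
    DifferentiableAt 𝕜 (chartFrame 𝕜 G) z :=
  (contDiffAt_chartFrame hz).differentiableAt (by simp)

theorem hasFDerivAt_chartMul_one (hz : z ∈ (oneChart 𝕜 E G).target) :
    HasFDerivAt (chartMul 𝕜 G z) (chartFrame 𝕜 G z) (oneChart 𝕜 E G 1) :=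
  (differentiableAt_chartMul hz (oneChart_one_mem_target 𝕜 E G) (mul_one_mem_source hz)).hasFDerivAt

theorem isInvertible_mfderiv_oneChart_symm (hz : z ∈ (oneChart 𝕜 E G).target) :
    (mfderiv 𝓘(𝕜, E) 𝓘(𝕜, E) (oneChart 𝕜 E G).symm z).IsInvertible := by
  have symm_comp :=
    mfderivWithin_extChartAt_symm_comp_mfderiv_extChartAt (I := 𝓘(𝕜, E)) (x := (1 : G)) hz
  have comp_symm :=
    mfderiv_extChartAt_comp_mfderivWithin_extChartAt_symm (I := 𝓘(𝕜, E)) (x := (1 : G)) hz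
  simp only [modelWithCornersSelf_coe, Set.range_id, mfderivWithin_univ] at symm_comp comp_symm
  exact ContinuousLinearMap.IsInvertible.of_inverse symm_comp comp_symm

theorem mfderiv_oneChart_symm_comp_chartFrame (hz : z ∈ (oneChart 𝕜 E G).target) (a : E) :
    (mfderiv 𝓘(𝕜, E) 𝓘(𝕜, E) (oneChart 𝕜 E G).symm z (chartFrame 𝕜 G z a) : E) =
      mfderiv 𝓘(𝕜, E) 𝓘(𝕜, E) (fun g => (oneChart 𝕜 E G).symm z * g) 1
        (mfderiv 𝓘(𝕜, E) 𝓘(𝕜, E) (oneChart 𝕜 E G).symm (oneChart 𝕜 E G 1) a) := by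
  have : ContinuousMul G := continuousMul_of_contMDiffMul 𝓘(𝕜, E) ∞
  have hasMFDerivAt_symm : HasMFDerivAt 𝓘(𝕜, E) 𝓘(𝕜, E) (oneChart 𝕜 E G).symm
      (chartMul 𝕜 G z (oneChart 𝕜 E G 1)) (mfderiv 𝓘(𝕜, E) 𝓘(𝕜, E) (oneChart 𝕜 E G).symm z) := by
    rw [chartMul_apply_one hz]
    exact hasMFDerivAt_oneChart_symm hz
  have hasMFDerivAt_mul_left : HasMFDerivAt 𝓘(𝕜, E) 𝓘(𝕜, E) (fun g => (oneChart 𝕜 E G).symm z * g)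
      ((oneChart 𝕜 E G).symm (oneChart 𝕜 E G 1))
      (mfderiv 𝓘(𝕜, E) 𝓘(𝕜, E) (fun g => (oneChart 𝕜 E G).symm z * g) 1) := by
    rw [oneChart_symm_apply_one]
    exact ((contMDiff_mul_left (I := 𝓘(𝕜, E)) (n := ∞)).contMDiffAt.mdifferentiableAt
      (by simp)).hasMFDerivAt
  have symm_comp_chartMul : (fun g => (oneChart 𝕜 E G).symm z * g) ∘ (oneChart 𝕜 E G).symm
      =ᶠ[𝓝 (oneChart 𝕜 E G 1)] (oneChart 𝕜 E G).symm ∘ chartMul 𝕜 G z :=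
    (eventually_mul_mem_source hz).mono fun w hw => (oneChart_symm_chartMul hw).symm
  exact DFunLike.congr_fun (hasMFDerivAt_unique
    ((hasMFDerivAt_symm.comp _ (hasFDerivAt_chartMul_one hz).hasMFDerivAt).congr_of_eventuallyEq
      symm_comp_chartMul)
    (hasMFDerivAt_mul_left.comp _ (hasMFDerivAt_oneChart_symm (oneChart_one_mem_target 𝕜 E G)))) a

variable (𝕜 E G) in
/-- The identification of the model space with the Lie algebra given by the chart. -/
def chartLieEquiv : E ≃ₗ[𝕜] GroupLieAlgebra 𝓘(𝕜, E) G :=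
  (isInvertible_mfderiv_oneChart_symm (oneChart_one_mem_target 𝕜 E G)).choose.toLinearEquiv

theorem chartLieEquiv_apply (a : E) : chartLieEquiv 𝕜 E G a =
    mfderiv 𝓘(𝕜, E) 𝓘(𝕜, E) (oneChart 𝕜 E G).symm (oneChart 𝕜 E G 1) a :=
  DFunLike.congr_fun
    (isInvertible_mfderiv_oneChart_symm (oneChart_one_mem_target 𝕜 E G)).choose_spec a

theorem mpullback_oneChart_symm (hz : z ∈ (oneChart 𝕜 E G).target) (a : E) :
    mpullback 𝓘(𝕜, E) 𝓘(𝕜, E) (oneChart 𝕜 E G).symm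
      (mulInvariantVectorField (chartLieEquiv 𝕜 E G a)) z = chartFrame 𝕜 G z a := by
  rw [mpullback_apply]
  refine (isInvertible_mfderiv_oneChart_symm hz).inverse_apply_eq.2 ?_
  refine Eq.trans ?_ (mfderiv_oneChart_symm_comp_chartFrame hz a).symm
  rw [chartLieEquiv_apply]
  rfl

variable [CompleteSpace E]

theorem lieBracket_chartFrame_eq_symm (hz : z ∈ (oneChart 𝕜 E G).target) (a b : E) :
    lieBracket 𝕜 (fun y => chartFrame 𝕜 G y a) (fun y => chartFrame 𝕜 G y b) z =
      chartFrame 𝕜 G z ((chartLieEquiv 𝕜 E G).symm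
        ⁅chartLieEquiv 𝕜 E G a, chartLieEquiv 𝕜 E G b⁆) := by
  have : IsTopologicalGroup G := topologicalGroup_of_lieGroup 𝓘(𝕜, E) ∞
  have mpullback_eventuallyEq (a : E) : mpullback 𝓘(𝕜, E) 𝓘(𝕜, E) (oneChart 𝕜 E G).symm
      (mulInvariantVectorField (chartLieEquiv 𝕜 E G a)) =ᶠ[𝓝 z] fun y => chartFrame 𝕜 G y a :=
    Filter.mem_of_superset (oneChart_target_mem_nhds hz) fun y hy => mpullback_oneChart_symm hy a
  have mpullback_bracket := mpullback_mlieBracket (I := 𝓘(𝕜, E)) (I' := 𝓘(𝕜, E)) (n := ∞)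
    (f := (oneChart 𝕜 E G).symm) (x₀ := z)
    (V := mulInvariantVectorField (chartLieEquiv 𝕜 E G a))
    (W := mulInvariantVectorField (chartLieEquiv 𝕜 E G b))
    (mdifferentiableAt_mulInvariantVectorField _) (mdifferentiableAt_mulInvariantVectorField _)
    (contMDiffAt_oneChart_symm hz) (by
      rw [minSmoothness_of_isRCLikeNormedField]
      exact ENat.LEInfty.out)
  rw [← mulInvariantVector_mlieBracket, ← GroupLieAlgebra.bracket_def,
    (mpullback_eventuallyEq a).mlieBracket_vectorField_eq (mpullback_eventuallyEq b),
    ← (chartLieEquiv 𝕜 E G).apply_symm_apply ⁅_, _⁆] at mpullback_bracket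
  exact (congrFun (mlieBracket_eq_lieBracket _ _) z).symm.trans
    (mpullback_bracket.symm.trans (mpullback_oneChart_symm hz _))

theorem chartLieEquiv_chartBr (a b : E) :
    chartLieEquiv 𝕜 E G (chartBr 𝕜 E G a b) = ⁅chartLieEquiv 𝕜 E G a, chartLieEquiv 𝕜 E G b⁆ := by
  have target := oneChart_one_mem_target 𝕜 E G
  have lieBracket_one := lieBracket_chartFrame_eq_symm target a b
  rw [lieBracket, fderiv_clm_apply_const (differentiableAt_chartFrame target),
    fderiv_clm_apply_const (differentiableAt_chartFrame target), chartFrame_one] at lieBracket_one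
  rw [← LinearEquiv.eq_symm_apply]
  exact lieBracket_one

theorem lieBracket_chartFrame (hz : z ∈ (oneChart 𝕜 E G).target) (a b : E) :
    lieBracket 𝕜 (fun y => chartFrame 𝕜 G y a) (fun y => chartFrame 𝕜 G y b) z =
      chartFrame 𝕜 G z (chartBr 𝕜 E G a b) := by
  rw [lieBracket_chartFrame_eq_symm hz, ← chartLieEquiv_chartBr, LinearEquiv.symm_apply_apply]

variable (𝕜 G) in
theorem exists_integralCurve_chartFrame [NormedSpace ℝ E] [IsScalarTower ℝ 𝕜 E] (x : E) :
    ∃ α : ℝ → E, α 0 = oneChart 𝕜 E G 1 ∧ ∀ᶠ t in 𝓝 0, HasDerivAt α (chartFrame 𝕜 G (α t) x) t := by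
  have contDiffAt_apply : ContDiffAt 𝕜 1 (fun z => chartFrame 𝕜 G z x) (oneChart 𝕜 E G 1) :=
    ((contDiffAt_chartFrame (oneChart_one_mem_target 𝕜 E G)).of_le (by simp)).clm_apply
      contDiffAt_const
  obtain ⟨α, α_zero, ε, hε, hα⟩ := (contDiffAt_apply.restrict_scalars ℝ
    ).exists_forall_mem_closedBall_exists_eq_forall_mem_Ioo_hasDerivAt₀ 0
  exact ⟨α, α_zero, mem_of_superset (Ioo_mem_nhds (by linarith) (by linarith)) hα⟩

theorem contDiffAt_chartForm (hz : z ∈ (oneChart 𝕜 E G).target)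
    (hu : IsUnit (chartFrame 𝕜 G z)) : ContDiffAt 𝕜 ∞ (chartForm 𝕜 G) z := by
  obtain ⟨U, hU⟩ := hu
  have contDiffAt_inverse := contDiffAt_ringInverse 𝕜 (n := ∞) U
  rw [hU] at contDiffAt_inverse
  exact contDiffAt_inverse.comp z (contDiffAt_chartFrame hz)

theorem differentiableAt_chartForm (hz : z ∈ (oneChart 𝕜 E G).target)
    (hu : IsUnit (chartFrame 𝕜 G z)) : DifferentiableAt 𝕜 (chartForm 𝕜 G) z :=
  (contDiffAt_chartForm hz hu).differentiableAt (by simp)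

variable (𝕜 E G) in
theorem eventually_isUnit_chartFrame :
    ∀ᶠ z in 𝓝 (oneChart 𝕜 E G 1), IsUnit (chartFrame 𝕜 G z) :=
  (contDiffAt_chartFrame (oneChart_one_mem_target 𝕜 E G)).continuousAt
    (Units.isOpen.mem_nhds (isUnit_chartFrame_one 𝕜 G))

theorem fderiv_chartForm_sub (hz : z ∈ (oneChart 𝕜 E G).target)
    (hu : ∀ᶠ y in 𝓝 z, IsUnit (chartFrame 𝕜 G y)) (u v : E) :
    fderiv 𝕜 (chartForm 𝕜 G) z u v - fderiv 𝕜 (chartForm 𝕜 G) z v u =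
      -chartBr 𝕜 E G (chartForm 𝕜 G z u) (chartForm 𝕜 G z v) := by
  have isUnit_z := hu.self_of_nhds
  have structure_equation := fderiv_coframe_sub_eq_neg_lieBracket (differentiableAt_chartFrame hz)
    (differentiableAt_chartForm hz isUnit_z) (hu.mono fun y hy => chartForm_chartFrame hy)
    (chartForm 𝕜 G z u) (chartForm 𝕜 G z v)
  rwa [lieBracket_chartFrame hz, chartForm_chartFrame isUnit_z, chartFrame_chartForm isUnit_z,
    chartFrame_chartForm isUnit_z] at structure_equation

end Smooth

theorem hasFDerivAt_chartMul [LieGroup 𝓘(𝕜, E) ∞ G]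
    (hz : z ∈ (oneChart 𝕜 E G).target) (hw : w ∈ (oneChart 𝕜 E G).target)
    (hzw : (oneChart 𝕜 E G).symm z * (oneChart 𝕜 E G).symm w ∈ (oneChart 𝕜 E G).source)
    (hu : IsUnit (chartFrame 𝕜 G w)) :
    HasFDerivAt (chartMul 𝕜 G z)
      ((chartFrame 𝕜 G (chartMul 𝕜 G z w)).comp (chartForm 𝕜 G w)) w := by
  have : ContinuousMul G := continuousMul_of_contMDiffMul 𝓘(𝕜, E) ∞
  have hasFDerivAt_mul := (differentiableAt_chartMul hz hw hzw).hasFDerivAt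
  have chartMul_assoc : chartMul 𝕜 G z ∘ chartMul 𝕜 G w =ᶠ[𝓝 (oneChart 𝕜 E G 1)]
      chartMul 𝕜 G (chartMul 𝕜 G z w) := by
    filter_upwards [eventually_mul_mem_source hw] with y hy
    rw [Function.comp_apply, chartMul, oneChart_symm_chartMul hy, chartMul,
      oneChart_symm_chartMul hzw, mul_assoc]
  have fderiv_comp_chartFrame : (fderiv 𝕜 (chartMul 𝕜 G z) w).comp (chartFrame 𝕜 G w) =
      chartFrame 𝕜 G (chartMul 𝕜 G z w) :=
    HasFDerivAt.unique (HasFDerivAt.comp _ (by rwa [chartMul_apply_one hw])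
      (hasFDerivAt_chartMul_one hw)) ((hasFDerivAt_chartMul_one
        ((oneChart 𝕜 E G).map_source hzw)).congr_of_eventuallyEq chartMul_assoc)
  refine hasFDerivAt_mul.congr_fderiv ?_
  rw [← fderiv_comp_chartFrame]
  ext a
  exact congrArg _ (chartFrame_chartForm hu a).symm

end LieGroupChart

section GlobalExponential

open Topology Filter Metric

section Dyadic

variable (𝕜 : Type*) {L G : Type*} [RCLike 𝕜] [NormedAddCommGroup L] [NormedSpace 𝕜 L]
  [Monoid G] {r : L → G} {ε : ℝ}

theorem inv_two_pow_smul_mem_ball {n : ℕ} {x : L} (hx : ‖x‖ < 2 ^ n * ε) :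
    ((2 : 𝕜) ^ n)⁻¹ • x ∈ ball (0 : L) ε := by
  rw [mem_ball_zero_iff, norm_smul, norm_inv, norm_pow, RCLike.norm_ofNat]
  exact (inv_mul_lt_iff₀ (by positivity)).2 hx

theorem apply_inv_two_pow_add_smul_pow (hε : 0 < ε)
    (hr : ∀ x ∈ ball (0 : L) ε, r ((2 : 𝕜)⁻¹ • x) ^ 2 = r x) {n : ℕ} {x : L}
    (hx : ‖x‖ < 2 ^ n * ε) (k : ℕ) :
    r (((2 : 𝕜) ^ (n + k))⁻¹ • x) ^ 2 ^ (n + k) = r (((2 : 𝕜) ^ n)⁻¹ • x) ^ 2 ^ n := by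
  induction k with
  | zero => rfl
  | succ k ih =>
    have hx_add : ‖x‖ < 2 ^ (n + k) * ε := hx.trans_le
      (mul_le_mul_of_nonneg_right (pow_le_pow_right₀ one_le_two (Nat.le_add_right n k)) hε.le)
    rw [← ih, ← hr _ (inv_two_pow_smul_mem_ball 𝕜 hx_add), smul_smul, ← mul_inv, ← pow_succ',
      ← pow_mul, ← pow_succ', add_assoc]

theorem exists_continuous_extension_of_sq [TopologicalSpace G] [ContinuousMul G]
    (hr : ∀ᶠ x in 𝓝 0, ContinuousAt r x)
    (hr_sq : ∀ᶠ x in 𝓝 0, r ((2 : 𝕜)⁻¹ • x) ^ 2 = r x) {s : Set L} (hs : s ∈ 𝓝 0) :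
    ∃ φ : L → G, Continuous φ ∧
      ∀ x, ∃ n : ℕ, ((2 : 𝕜) ^ n)⁻¹ • x ∈ s ∧ φ x = r (((2 : 𝕜) ^ n)⁻¹ • x) ^ 2 ^ n := by
  obtain ⟨ε, hε, hball⟩ := eventually_nhds_iff_ball.1 ((hr.and hr_sq).and hs)
  have exists_lt (x : L) : ∃ n : ℕ, ‖x‖ < 2 ^ n * ε := by
    obtain ⟨n, hn⟩ := pow_unbounded_of_one_lt (‖x‖ / ε) (one_lt_two (α := ℝ))
    exact ⟨n, (div_lt_iff₀ hε).1 hn⟩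
  choose n hn using exists_lt
  have independent {m : ℕ} {x : L} (hm : ‖x‖ < 2 ^ m * ε) :
      r (((2 : 𝕜) ^ m)⁻¹ • x) ^ 2 ^ m = r (((2 : 𝕜) ^ n x)⁻¹ • x) ^ 2 ^ n x := by
    have hr_sq_ball : ∀ y ∈ ball (0 : L) ε, r ((2 : 𝕜)⁻¹ • y) ^ 2 = r y :=
      fun y hy => (hball y hy).1.2
    rw [← apply_inv_two_pow_add_smul_pow 𝕜 hε hr_sq_ball hm (n x),
      ← apply_inv_two_pow_add_smul_pow 𝕜 hε hr_sq_ball (hn x) m, add_comm]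
  refine ⟨fun x => r (((2 : 𝕜) ^ n x)⁻¹ • x) ^ 2 ^ n x, continuous_iff_continuousAt.2 fun x => ?_,
    fun x => ⟨n x, (hball _ (inv_two_pow_smul_mem_ball 𝕜 (hn x))).2, rfl⟩⟩
  have continuousAt_pow : ContinuousAt (fun y => r (((2 : 𝕜) ^ n x)⁻¹ • y) ^ 2 ^ n x) x :=
    (ContinuousAt.comp (f := fun y : L => ((2 : 𝕜) ^ n x)⁻¹ • y)
      (hball _ (inv_two_pow_smul_mem_ball 𝕜 (hn x))).1.1
      (continuous_const_smul _).continuousAt).pow _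
  refine continuousAt_pow.congr ?_
  filter_upwards [(isOpen_lt continuous_norm continuous_const).mem_nhds (hn x)] with y hy
  exact independent hy

end Dyadic

variable {𝕜 L A G : Type*} [RCLike 𝕜] [NormedAddCommGroup L] [NormedSpace 𝕜 L]
  [NormedRing A] [NormedAlgebra 𝕜 A] [Group G] [TopologicalSpace G]
  {ρ : L →L[𝕜] A} {log : A → L} {π : G →* A}

/-- The logarithm of the homomorphism `π`, which is `log ∘ π` wherever `π` takes values in
`exp (ρ L)`, is injective near each point with this property. -/
def LogLocallyInjective (ρ : L →L[𝕜] A) (log : A → L) (π : G →* A) : Prop :=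
  ∀ g x, π g = NormedSpace.exp (ρ x) → ∃ W ∈ 𝓝 g, Set.InjOn (fun h => log (π h)) W

namespace LogLocallyInjective

theorem apply_log_eq_self [PreconnectedSpace G] [T2Space G] (hπ : LogLocallyInjective ρ log π)
    (hπ_cont : Continuous π) (hlog_cont : Continuous log)
    (hlog : ∀ x, log (NormedSpace.exp (ρ x)) = x) {φ : L → G} (hφ : Continuous φ)
    (hφ_zero : φ 0 = 1) (hφ_exp : ∀ x, π (φ x) = NormedSpace.exp (ρ x)) (g : G) :
    φ (log (π g)) = g := by
  have continuous_comp : Continuous fun g => φ (log (π g)) := hφ.comp (hlog_cont.comp hπ_cont)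
  have isClopen : IsClopen {g | φ (log (π g)) = g} := by
    refine ⟨isClosed_eq continuous_comp continuous_id, isOpen_iff_mem_nhds.2 fun g hg => ?_⟩
    change φ (log (π g)) = g at hg
    obtain ⟨W, hW, injOn⟩ := hπ g (log (π g)) (by rw [← hφ_exp, hg])
    have tendsto_g : Tendsto (fun g => φ (log (π g))) (𝓝 g) (𝓝 g) := by
      have := continuous_comp.tendsto g
      rwa [hg] at this
    filter_upwards [hW, tendsto_g hW] with h mem_W apply_mem_W
    exact injOn apply_mem_W mem_W (by simp only [hφ_exp, hlog])
  have log_one : log 1 = 0 := by simpa using hlog 0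
  exact Set.eq_univ_iff_forall.1 (isClopen.eq_univ ⟨1, by simp [log_one, hφ_zero]⟩) g

variable [CompleteSpace A]

theorem eventually_eq_exp [ContinuousMul G] (hπ : LogLocallyInjective ρ log π)
    (hlog : ∀ x, log (NormedSpace.exp (ρ x)) = x) {x : L} {γ c : ℝ → G} {t : ℝ}
    (hγ : Tendsto γ (𝓝[>] t) (𝓝 (γ t)))
    (hγ_log : ∀ᶠ s in 𝓝[>] t, log (π (γ s)) = (s : 𝕜) • x)
    (hγ_exp : π (γ t) = NormedSpace.exp (ρ ((t : 𝕜) • x)))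
    (hc : Tendsto c (𝓝 0) (𝓝 1))
    (hc_exp : ∀ᶠ s in 𝓝 (0 : ℝ), π (c s) = NormedSpace.exp (ρ ((s : 𝕜) • x))) :
    ∀ᶠ s in 𝓝[>] t, π (γ s) = NormedSpace.exp (ρ ((s : 𝕜) • x)) := by
  let : NormedAlgebra ℚ A := NormedAlgebra.restrictScalars ℚ 𝕜 A
  obtain ⟨W, hW, injOn⟩ := hπ _ _ hγ_exp
  have tendsto_sub : Tendsto (fun s : ℝ => s - t) (𝓝[>] t) (𝓝 0) := by
    have := ((continuous_sub_right t).tendsto t).mono_left (nhdsWithin_le_nhds (s := Set.Ioi t))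
    rwa [sub_self] at this
  have tendsto_mul : Tendsto (fun s => γ t * c (s - t)) (𝓝[>] t) (𝓝 (γ t)) := by
    have := (hc.comp tendsto_sub).const_mul (γ t)
    rwa [mul_one] at this
  filter_upwards [hγ hW, tendsto_mul hW, hγ_log, tendsto_sub.eventually hc_exp]
    with s mem_W mul_mem_W log_eq c_eq
  have mul_eq_exp : π (γ t * c (s - t)) = NormedSpace.exp (ρ ((s : 𝕜) • x)) := by
    rw [map_mul, hγ_exp, c_eq, map_smul, map_smul, map_smul, ← NormedSpace.exp_add_of_commute
      (((Commute.refl (ρ x)).smul_left _).smul_right _), ← add_smul, ← RCLike.ofReal_add,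
      add_sub_cancel]
  have eq_mul : γ s = γ t * c (s - t) :=
    injOn mem_W mul_mem_W (by simp only [mul_eq_exp, hlog, log_eq])
  rw [eq_mul, mul_eq_exp]

theorem eqOn_exp [ContinuousMul G] (hπ : LogLocallyInjective ρ log π) (hπ_cont : Continuous π)
    (hlog : ∀ x, log (NormedSpace.exp (ρ x)) = x) {x : L} {γ c : ℝ → G}
    (hγ : ContinuousOn γ (Set.Icc 0 1)) (hγ_zero : γ 0 = 1)
    (hγ_log : ∀ s ∈ Set.Icc 0 1, log (π (γ s)) = (s : 𝕜) • x)
    (hc : Tendsto c (𝓝 0) (𝓝 1))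
    (hc_exp : ∀ᶠ s in 𝓝 (0 : ℝ), π (c s) = NormedSpace.exp (ρ ((s : 𝕜) • x))) :
    Set.EqOn (fun s => π (γ s)) (fun s => NormedSpace.exp (ρ ((s : 𝕜) • x))) (Set.Icc 0 1) := by
  let : NormedAlgebra ℚ A := NormedAlgebra.restrictScalars ℚ 𝕜 A
  have continuous_exp : Continuous fun s : ℝ => NormedSpace.exp (ρ ((s : 𝕜) • x)) :=
    NormedSpace.exp_continuous.comp
      (ρ.continuous.comp (RCLike.continuous_ofReal.smul continuous_const))
  have isClosed_inter : IsClosed ({s | π (γ s) = NormedSpace.exp (ρ ((s : 𝕜) • x))} ∩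
      Set.Icc (0 : ℝ) 1) := by
    rw [Set.inter_comm]
    exact isClosed_Icc.isClosed_eq (hπ_cont.comp_continuousOn hγ) continuous_exp.continuousOn
  refine isClosed_inter.Icc_subset_of_forall_mem_nhdsWithin (by simp [hγ_zero]) ?_
  rintro t ⟨hγ_exp, ht⟩
  have Icc_mem : Set.Icc (0 : ℝ) 1 ∈ 𝓝[>] t :=
    mem_of_superset (Icc_mem_nhdsGT ht.2) (Set.Icc_subset_Icc_left ht.1)
  exact hπ.eventually_eq_exp hlog ((hγ t (Set.Ico_subset_Icc_self ht)).mono_left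
    (nhdsWithin_le_iff.2 Icc_mem)) (mem_of_superset Icc_mem hγ_log) hγ_exp hc hc_exp

theorem eventually_apply_eq_exp [ContinuousMul G] (hπ : LogLocallyInjective ρ log π)
    (hπ_cont : Continuous π) (hlog : ∀ x, log (NormedSpace.exp (ρ x)) = x)
    {r : L → G} (hr_zero : r 0 = 1) (hr : ∀ᶠ x in 𝓝 0, ContinuousAt r x ∧ log (π (r x)) = x)
    (hcurve : ∀ x, ∃ c : ℝ → G, Tendsto c (𝓝 0) (𝓝 1) ∧
      ∀ᶠ t in 𝓝 (0 : ℝ), π (c t) = NormedSpace.exp (ρ ((t : 𝕜) • x))) :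
    ∀ᶠ x in 𝓝 0, π (r x) = NormedSpace.exp (ρ x) := by
  obtain ⟨ε, hε, hball⟩ := eventually_nhds_iff_ball.1 hr
  filter_upwards [ball_mem_nhds 0 hε] with x hx
  have smul_mem : ∀ t ∈ Set.Icc (0 : ℝ) 1, (t : 𝕜) • x ∈ ball (0 : L) ε := by
    intro t ht
    rw [mem_ball_zero_iff] at hx ⊢
    rw [norm_smul, RCLike.norm_ofReal, abs_of_nonneg ht.1]
    exact (mul_le_of_le_one_left (norm_nonneg _) ht.2).trans_lt hx
  have continuousOn_ray : ContinuousOn (fun t : ℝ => r ((t : 𝕜) • x)) (Set.Icc 0 1) := fun t ht =>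
    (ContinuousAt.comp (f := fun t : ℝ => (t : 𝕜) • x) (hball _ (smul_mem t ht)).1
      (RCLike.continuous_ofReal.smul continuous_const).continuousAt).continuousWithinAt
  obtain ⟨c, hc, hc_exp⟩ := hcurve x
  simpa using hπ.eqOn_exp hπ_cont hlog continuousOn_ray (by simp [hr_zero])
    (fun t ht => (hball _ (smul_mem t ht)).2) hc hc_exp ⟨zero_le_one, le_rfl⟩

theorem exists_continuous_exp [ContinuousMul G] (hπ : LogLocallyInjective ρ log π)
    {r : L → G} (hr_zero : r 0 = 1) (hr : ∀ᶠ x in 𝓝 0, ContinuousAt r x)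
    (hr_exp : ∀ᶠ x in 𝓝 0, π (r x) = NormedSpace.exp (ρ x)) :
    ∃ φ : L → G, Continuous φ ∧ φ 0 = 1 ∧ ∀ x, π (φ x) = NormedSpace.exp (ρ x) := by
  let : NormedAlgebra ℚ A := NormedAlgebra.restrictScalars ℚ 𝕜 A
  obtain ⟨W, hW, injOn⟩ := hπ 1 0 (by simp)
  have tendsto_half : Tendsto (fun x : L => (2 : 𝕜)⁻¹ • x) (𝓝 0) (𝓝 0) := by
    have := (continuous_const_smul (2 : 𝕜)⁻¹).tendsto (0 : L)
    rwa [smul_zero] at this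
  have tendsto_r : Tendsto r (𝓝 0) (𝓝 1) := by
    have := hr.self_of_nhds.tendsto
    rwa [hr_zero] at this
  have tendsto_sq : Tendsto (fun x => r ((2 : 𝕜)⁻¹ • x) ^ 2) (𝓝 0) (𝓝 1) := by
    have := (tendsto_r.comp tendsto_half).pow 2
    rwa [one_pow] at this
  have exp_inv_smul_pow (x : L) {n : ℕ} (hn : n ≠ 0) :
      NormedSpace.exp (ρ ((n : 𝕜)⁻¹ • x)) ^ n = NormedSpace.exp (ρ x) := by
    rw [← NormedSpace.exp_nsmul, ← Nat.cast_smul_eq_nsmul 𝕜, ← map_smul,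
      smul_inv_smul₀ (Nat.cast_ne_zero.2 hn)]
  have r_sq : ∀ᶠ x in 𝓝 0, r ((2 : 𝕜)⁻¹ • x) ^ 2 = r x := by
    filter_upwards [tendsto_r hW, tendsto_sq hW, hr_exp, tendsto_half.eventually hr_exp]
      with x mem_W sq_mem_W exp_x exp_half
    refine injOn sq_mem_W mem_W ?_
    simp only [map_pow, exp_x, exp_half]
    exact congrArg log (mod_cast exp_inv_smul_pow x two_ne_zero)
  obtain ⟨φ, continuous_φ, hφ⟩ := exists_continuous_extension_of_sq 𝕜 hr r_sq hr_exp
  refine ⟨φ, continuous_φ, ?_, fun x => ?_⟩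
  · obtain ⟨n, -, φ_zero⟩ := hφ 0
    rw [φ_zero, smul_zero, hr_zero, one_pow]
  · obtain ⟨n, exp_x, φ_x⟩ := hφ x
    rw [φ_x, map_pow, exp_x]
    exact_mod_cast exp_inv_smul_pow x (pow_ne_zero n two_ne_zero)

end LogLocallyInjective

end GlobalExponential

section ChartFlat

section FlatUniqueness

open Metric

theorem eq_mul_of_flat {𝕜 E A : Type*} [RCLike 𝕜] [NormedAddCommGroup E] [NormedSpace 𝕜 E]
    [NormedRing A] [NormedAlgebra 𝕜 A] [CompleteSpace A] {e : E} {r : ℝ} {θ : E → E →L[𝕜] A}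
    {f P : E → A}
    (hf : ∀ z ∈ ball e r, HasFDerivAt f ((ContinuousLinearMap.mul 𝕜 A (f z)).comp (θ z)) z)
    (hP : ∀ z ∈ ball e r, HasFDerivAt P ((ContinuousLinearMap.mul 𝕜 A (P z)).comp (θ z)) z)
    (hPu : ∀ z ∈ ball e r, IsUnit (P z)) (hPe : P e = 1) {z : E} (hz : z ∈ ball e r) :
    f z = f e * P z := by
  have mul_inverse_eq : f z * Ring.inverse (P z) = f e := by
    refine eqOn_ball_of_hasFDerivAt (f := fun z => f z * Ring.inverse (P z)) (g := fun _ => f e)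
      (f' := fun _ => (0 : E →L[𝕜] A)) (fun z hz => ?_) (fun z _ => hasFDerivAt_const _ _)
      (by simp [hPe]) hz
    obtain ⟨p, hp⟩ := hPu z hz
    have hasFDerivAt_inverse := hasFDerivAt_ringInverse (𝕜 := 𝕜) p
    rw [hp] at hasFDerivAt_inverse
    refine ((hf z hz).mul' (hasFDerivAt_inverse.comp z (hP z hz))).congr_fderiv ?_
    ext u
    simp [← hp, mul_assoc]
  rw [← mul_inverse_eq, Ring.inverse_mul_cancel_right _ _ (hPu z hz)]

end FlatUniqueness

open Topology Filter Metric

/-- In the chart at the identity and on the ball of radius `r`, the function `P` is the unit-valued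
solution of `dP = P · ρ(θ)` with `P(1) = 1`, where `θ` is the Maurer-Cartan form. In other words,
`P` is a homomorphism near the identity with derivative `ρ`. -/
structure IsChartFlat {𝕜 E A : Type*} (G : Type*) [RCLike 𝕜] [NormedAddCommGroup E]
    [NormedSpace 𝕜 E] [NormedRing A] [NormedAlgebra 𝕜 A] [TopologicalSpace G] [ChartedSpace E G]
    [Group G] (ρ : E →L[𝕜] A) (P : E → A) (r : ℝ) : Prop where
  pos : 0 < r
  ball_subset : ball (oneChart 𝕜 E G 1) r ⊆ (oneChart 𝕜 E G).target
  isUnit_chartFrame : ∀ z ∈ ball (oneChart 𝕜 E G 1) r, IsUnit (chartFrame 𝕜 G z)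
  apply_one : P (oneChart 𝕜 E G 1) = 1
  isUnit_apply : ∀ z ∈ ball (oneChart 𝕜 E G 1) r, IsUnit (P z)
  hasFDerivAt : ∀ z ∈ ball (oneChart 𝕜 E G 1) r,
    HasFDerivAt P ((ContinuousLinearMap.mul 𝕜 A (P z)).comp (ρ.comp (chartForm 𝕜 G z))) z

variable {𝕜 E A G F : Type*} [RCLike 𝕜] [NormedAddCommGroup E] [NormedSpace 𝕜 E]
  [NormedRing A] [NormedAlgebra 𝕜 A] [TopologicalSpace G] [ChartedSpace E G] [Group G]
  [NormedAddCommGroup F] [NormedSpace 𝕜 F]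

theorem NilpotentRep.exists_isChartFlat [LieGroup 𝓘(𝕜, E) ∞ G] [CompleteSpace E] [CompleteSpace F]
    {N : ℕ} {B : NilpotentBracket 𝕜 E N} (R : NilpotentRep B F) (hB : B.br = chartBr 𝕜 E G) :
    ∃ P r, IsChartFlat G R.rep P r := by
  obtain ⟨r, hr, hball⟩ := eventually_nhds_iff_ball.1
    ((eventually_mem_nhds_iff.2 (oneChart_target_mem_nhds (oneChart_one_mem_target 𝕜 E G))).and
      (eventually_isUnit_chartFrame 𝕜 E G))
  have target {z : E} (hz : z ∈ ball (oneChart 𝕜 E G 1) r) : z ∈ (oneChart 𝕜 E G).target :=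
    mem_of_mem_nhds (hball z hz).1
  obtain ⟨P, P_one, hP⟩ := R.exists_flat (θ := chartForm 𝕜 G)
    (fun z hz => differentiableAt_chartForm (target hz) (hball z hz).2)
    (fun z hz u v => hB ▸ fderiv_chartForm_sub (target hz)
      (mem_of_superset (isOpen_ball.mem_nhds hz) fun y hy => (hball y hy).2) u v)
  have isUnit_P : ∀ᶠ z in 𝓝 (oneChart 𝕜 E G 1), IsUnit (P z) :=
    (hP _ (mem_ball_self hr)).continuousAt (Units.isOpen.mem_nhds (P_one ▸ isUnit_one))
  obtain ⟨s, hs, hPu⟩ := eventually_nhds_iff_ball.1 isUnit_P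
  have subset_r : ball (oneChart 𝕜 E G 1) (min r s) ⊆ ball (oneChart 𝕜 E G 1) r :=
    ball_subset_ball (min_le_left _ _)
  exact ⟨P, min r s, lt_min hr hs, fun z hz => target (subset_r hz),
    fun z hz => (hball z (subset_r hz)).2, P_one,
    fun z hz => hPu z (ball_subset_ball (min_le_right _ _) hz), fun z hz => hP z (subset_r hz)⟩

namespace IsChartFlat

variable {ρ : E →L[𝕜] A} {P : E → A} {r : ℝ}

theorem continuousAt_one (h : IsChartFlat G ρ P r) : ContinuousAt P (oneChart 𝕜 E G 1) :=
  (h.hasFDerivAt _ (mem_ball_self h.pos)).continuousAt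

theorem eventually_apply_chartMul [LieGroup 𝓘(𝕜, E) ∞ G] [CompleteSpace A]
    (h : IsChartFlat G ρ P r) {z : E} (hz : z ∈ ball (oneChart 𝕜 E G 1) r) :
    ∀ᶠ w in 𝓝 (oneChart 𝕜 E G 1), P (chartMul 𝕜 G z w) = P z * P w := by
  have : ContinuousMul G := continuousMul_of_contMDiffMul 𝓘(𝕜, E) ∞
  have mul_mem_ball : ∀ᶠ w in 𝓝 (oneChart 𝕜 E G 1),
      chartMul 𝕜 G z w ∈ ball (oneChart 𝕜 E G 1) r :=
    (hasFDerivAt_chartMul_one (h.ball_subset hz)).continuousAt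
      (isOpen_ball.mem_nhds (by rwa [chartMul_apply_one (h.ball_subset hz)]))
  obtain ⟨s, hs, hball⟩ := eventually_nhds_iff_ball.1
    ((mul_mem_ball.and (eventually_mul_mem_source (h.ball_subset hz))).and (ball_mem_nhds _ h.pos))
  have flat_translate : ∀ w ∈ ball (oneChart 𝕜 E G 1) s,
      HasFDerivAt (fun w => P (chartMul 𝕜 G z w)) ((ContinuousLinearMap.mul 𝕜 A
        (P (chartMul 𝕜 G z w))).comp (ρ.comp (chartForm 𝕜 G w))) w := by
    intro w hw
    obtain ⟨⟨hzw, hzw_source⟩, hw_ball⟩ := hball w hw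
    refine ((h.hasFDerivAt _ hzw).comp w (hasFDerivAt_chartMul (h.ball_subset hz)
      (h.ball_subset hw_ball) hzw_source (h.isUnit_chartFrame w hw_ball))).congr_fderiv ?_
    ext1 u
    simp [chartForm_chartFrame (h.isUnit_chartFrame _ hzw)]
  filter_upwards [ball_mem_nhds _ hs] with w hw
  have apply_eq := eq_mul_of_flat flat_translate (fun w hw => h.hasFDerivAt w (hball w hw).2)
    (fun w hw => h.isUnit_apply w (hball w hw).2) h.apply_one hw
  rwa [chartMul_apply_one (h.ball_subset hz)] at apply_eq

theorem exists_monoidHom [LieGroup 𝓘(𝕜, E) ∞ G] [CompleteSpace A] [SimplyConnectedSpace G]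
    (h : IsChartFlat G ρ P r) :
    ∃ π : G →* A, Continuous π ∧ ∀ᶠ g in 𝓝 (1 : G), π g = P (oneChart 𝕜 E G g) := by
  have : IsTopologicalGroup G := topologicalGroup_of_lieGroup 𝓘(𝕜, E) ∞
  let : NormedSpace ℝ E := .restrictScalars ℝ 𝕜 E
  have : LocallyPathConnectedSpace G := ChartedSpace.locallyPathConnectedSpace E G
  have isOpen_source : IsOpen (oneChart 𝕜 E G).source :=
    isOpen_extChartAt_source (I := 𝓘(𝕜, E)) (1 : G)
  have one_mem_source : 1 ∈ (oneChart 𝕜 E G).source := mem_extChartAt_source (I := 𝓘(𝕜, E)) (1 : G)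
  have isOpen_U := (continuousOn_extChartAt (I := 𝓘(𝕜, E)) (1 : G)).isOpen_inter_preimage
    isOpen_source (isOpen_ball (x := oneChart 𝕜 E G 1) (ε := r))
  obtain ⟨π, hπ⟩ := exists_monoidHom_of_local_isUnit isOpen_U
    ⟨one_mem_source, mem_ball_self h.pos⟩ (fun a ha => h.isUnit_apply _ ha.2) (by
      rintro a ⟨ha_source, ha_ball⟩
      filter_upwards [isOpen_source.mem_nhds one_mem_source,
        (continuousAt_oneChart 𝕜 E G).eventually (h.eventually_apply_chartMul ha_ball)]
        with u hu P_mul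
      rwa [chartMul, (oneChart 𝕜 E G).left_inv ha_source, (oneChart 𝕜 E G).left_inv hu] at P_mul)
  have continuousAt_comp : ContinuousAt (fun g => P (oneChart 𝕜 E G g)) 1 :=
    h.continuousAt_one.comp (continuousAt_oneChart 𝕜 E G)
  exact ⟨π, continuous_of_continuousAt_one _
    (continuousAt_comp.congr (hπ.mono fun _ h => h.symm)), hπ⟩

theorem eventually_apply_integralCurve [NormedSpace ℝ E] [IsScalarTower ℝ 𝕜 E] [CompleteSpace A]
    (h : IsChartFlat G ρ P r) {α : ℝ → E} {x : E} (hα_zero : α 0 = oneChart 𝕜 E G 1)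
    (hα : ∀ᶠ t in 𝓝 0, HasDerivAt α (chartFrame 𝕜 G (α t) x) t) :
    ∀ᶠ t : ℝ in 𝓝 0, P (α t) = NormedSpace.exp (ρ ((t : 𝕜) • x)) := by
  let : NormedAlgebra ℝ A := .restrictScalars ℝ 𝕜 A
  let : NormedAlgebra ℚ A := .restrictScalars ℚ 𝕜 A
  have mem_ball : ∀ᶠ t in 𝓝 0, α t ∈ ball (oneChart 𝕜 E G 1) r :=
    hα.self_of_nhds.continuousAt (hα_zero ▸ ball_mem_nhds _ h.pos)
  obtain ⟨δ, hδ, hball⟩ := eventually_nhds_iff_ball.1 (hα.and mem_ball)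
  filter_upwards [ball_mem_nhds 0 hδ] with t ht
  have flat_curve : ∀ t ∈ ball (0 : ℝ) δ, HasFDerivAt (fun t => P (α t))
      ((ContinuousLinearMap.mul ℝ A (P (α t))).comp
        (ContinuousLinearMap.toSpanSingleton ℝ (ρ x))) t := by
    intro t ht
    obtain ⟨hasDerivAt_α, α_mem⟩ := hball t ht
    refine (((h.hasFDerivAt _ α_mem).restrictScalars ℝ).comp_hasDerivAt t
      hasDerivAt_α).hasFDerivAt.congr_fderiv ?_
    ext
    simp [chartForm_chartFrame (h.isUnit_chartFrame _ α_mem)]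
  have flat_exp : ∀ t ∈ ball (0 : ℝ) δ, HasFDerivAt (fun t : ℝ => NormedSpace.exp (t • ρ x))
      ((ContinuousLinearMap.mul ℝ A (NormedSpace.exp (t • ρ x))).comp
        (ContinuousLinearMap.toSpanSingleton ℝ (ρ x))) t := by
    intro t _
    refine (hasDerivAt_exp_smul_const (𝕂 := ℝ) (ρ x) t).hasFDerivAt.congr_fderiv ?_
    ext
    simp
  have apply_eq := eq_mul_of_flat flat_curve flat_exp (fun t _ => NormedSpace.isUnit_exp _)
    (by simp) ht
  rw [hα_zero, h.apply_one, one_mul] at apply_eq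
  rw [apply_eq, map_smul]
  rfl

end IsChartFlat

end ChartFlat

section LocalExponential

open Topology Filter Metric

variable {𝕜 E A G F : Type*} [RCLike 𝕜] [NormedAddCommGroup E] [NormedSpace 𝕜 E] [CompleteSpace E]
  [NormedRing A] [NormedAlgebra 𝕜 A] [NormedAddCommGroup F] [NormedSpace 𝕜 F]
  [TopologicalSpace G] [ChartedSpace E G] [Group G] [LieGroup 𝓘(𝕜, E) ∞ G]

namespace IsChartFlat

section Logarithm

variable {N : ℕ} {B : NilpotentBracket 𝕜 E N} {R : NilpotentRep B F} {P : E → F →L[𝕜] F} {r : ℝ}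

theorem hasStrictFDerivAt_one {ρ : E →L[𝕜] A} {P : E → A} (h : IsChartFlat G ρ P r) :
    HasStrictFDerivAt P ρ (oneChart 𝕜 E G 1) := by
  have continuousAt_form : ContinuousAt (chartForm 𝕜 G) (oneChart 𝕜 E G 1) :=
    (differentiableAt_chartForm (oneChart_one_mem_target 𝕜 E G)
      (isUnit_chartFrame_one 𝕜 G)).continuousAt
  have continuousAt_fderiv : ContinuousAt (fun z =>
      (ContinuousLinearMap.mul 𝕜 A (P z)).comp (ρ.comp (chartForm 𝕜 G z))) (oneChart 𝕜 E G 1) :=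
    ((ContinuousLinearMap.mul 𝕜 A).continuous.continuousAt.comp h.continuousAt_one).clm_comp
      (continuousAt_const.clm_comp continuousAt_form)
  refine (hasStrictFDerivAt_of_hasFDerivAt_of_continuousAt
    (mem_of_superset (ball_mem_nhds _ h.pos) h.hasFDerivAt) continuousAt_fderiv).congr_fderiv ?_
  rw [h.apply_one, chartForm_one]
  ext u
  simp

theorem exists_hasStrictFDerivAt_log (h : IsChartFlat G R.rep P r) (x : E) :
    ∃ e : E ≃L[𝕜] E, HasStrictFDerivAt (fun z => R.log (NormedSpace.exp (R.rep x) * P z))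
      (e : E →L[𝕜] E) (oneChart 𝕜 E G 1) := by
  obtain ⟨e, he⟩ := R.log_exp_mul x
  refine ⟨e, ((R.log.comp (ContinuousLinearMap.mul 𝕜 (F →L[𝕜] F)
    (NormedSpace.exp (R.rep x)))).hasStrictFDerivAt.comp _ h.hasStrictFDerivAt_one).congr_fderiv ?_⟩
  ext u
  simp [he]

theorem logLocallyInjective (h : IsChartFlat G R.rep P r) {π : G →* (F →L[𝕜] F)}
    (hπ : ∀ᶠ g in 𝓝 (1 : G), π g = P (oneChart 𝕜 E G g)) :
    LogLocallyInjective R.rep R.log π := by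
  have : IsTopologicalGroup G := topologicalGroup_of_lieGroup 𝓘(𝕜, E) ∞
  intro g x hg
  obtain ⟨e, he⟩ := h.exists_hasStrictFDerivAt_log x
  let Φ := he.toOpenPartialHomeomorph _
  have mem_source : ∀ᶠ u in 𝓝 (1 : G), oneChart 𝕜 E G u ∈ Φ.source :=
    (continuousAt_oneChart 𝕜 E G) (Φ.open_source.mem_nhds he.mem_toOpenPartialHomeomorph_source)
  have log_apply {a : G} (ha : π (g⁻¹ * a) = P (oneChart 𝕜 E G (g⁻¹ * a))) :
      R.log (π a) = Φ (oneChart 𝕜 E G (g⁻¹ * a)) := by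
    change _ = R.log (NormedSpace.exp (R.rep x) * P (oneChart 𝕜 E G (g⁻¹ * a)))
    rw [← ha, ← hg, ← map_mul, mul_inv_cancel_left]
  have tendsto_inv_mul : Tendsto (g⁻¹ * ·) (𝓝 g) (𝓝 1) := by
    simpa using (continuous_const_mul g⁻¹).tendsto g
  refine ⟨_, tendsto_inv_mul.eventually
    ((mem_source.and (extChartAt_source_mem_nhds (I := 𝓘(𝕜, E)) (1 : G))).and hπ), ?_⟩
  rintro a ⟨⟨ha_Φ, ha_source⟩, ha⟩ b ⟨⟨hb_Φ, hb_source⟩, hb⟩ hab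
  simp only [log_apply ha, log_apply hb] at hab
  exact mul_left_cancel
    ((oneChart 𝕜 E G).injOn ha_source hb_source (Φ.injOn ha_Φ hb_Φ hab))

theorem exists_localInverse_log (h : IsChartFlat G R.rep P r) {π : G →* (F →L[𝕜] F)}
    (hπ : ∀ᶠ g in 𝓝 (1 : G), π g = P (oneChart 𝕜 E G g)) :
    ∃ q : E → G, q 0 = 1 ∧ ∀ᶠ x in 𝓝 0, ContinuousAt q x ∧ R.log (π (q x)) = x := by
  obtain ⟨e, he⟩ := h.exists_hasStrictFDerivAt_log 0
  let Φ := he.toOpenPartialHomeomorph _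
  have Φ_apply (z : E) : Φ z = R.log (P z) := by
    change R.log (NormedSpace.exp (R.rep 0) * P z) = _
    rw [map_zero, NormedSpace.exp_zero, one_mul]
  have one_mem_source : oneChart 𝕜 E G 1 ∈ Φ.source := he.mem_toOpenPartialHomeomorph_source
  have Φ_one : Φ (oneChart 𝕜 E G 1) = 0 := by
    rw [Φ_apply, h.apply_one, ← NormedSpace.exp_zero, ← map_zero R.rep, R.log_exp]
  have zero_mem_target : (0 : E) ∈ Φ.target := Φ_one ▸ Φ.map_source one_mem_source
  have symm_zero : Φ.symm 0 = oneChart 𝕜 E G 1 := by rw [← Φ_one, Φ.left_inv one_mem_source]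
  have tendsto_symm : Tendsto Φ.symm (𝓝 0) (𝓝 (oneChart 𝕜 E G 1)) :=
    symm_zero ▸ Φ.continuousAt_symm zero_mem_target
  refine ⟨fun x => (oneChart 𝕜 E G).symm (Φ.symm x), by
    simp only [symm_zero, oneChart_symm_apply_one], ?_⟩
  filter_upwards [Φ.open_target.mem_nhds zero_mem_target, tendsto_symm (ball_mem_nhds _ h.pos),
    ((tendsto_oneChart_symm 𝕜 E G).comp tendsto_symm).eventually hπ] with x hx symm_mem π_eq
  have symm_mem_target := h.ball_subset symm_mem
  refine ⟨ContinuousAt.comp (continuousAt_extChartAt_symm'' (I := 𝓘(𝕜, E)) symm_mem_target)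
    (Φ.continuousAt_symm hx), ?_⟩
  rw [Function.comp_apply] at π_eq
  rw [π_eq, (oneChart 𝕜 E G).right_inv symm_mem_target, ← Φ_apply, Φ.right_inv hx]

end Logarithm

theorem exists_oneParameterSubgroup [CompleteSpace A] {ρ : E →L[𝕜] A} {P : E → A} {r : ℝ}
    (h : IsChartFlat G ρ P r) {π : G →* A}
    (hπ : ∀ᶠ g in 𝓝 (1 : G), π g = P (oneChart 𝕜 E G g)) (x : E) :
    ∃ c : ℝ → G, Tendsto c (𝓝 0) (𝓝 1) ∧
      ∀ᶠ t in 𝓝 (0 : ℝ), π (c t) = NormedSpace.exp (ρ ((t : 𝕜) • x)) := by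
  let : NormedSpace ℝ E := .restrictScalars ℝ 𝕜 E
  obtain ⟨α, α_zero, hα⟩ := exists_integralCurve_chartFrame 𝕜 G x
  have tendsto_α : Tendsto α (𝓝 0) (𝓝 (oneChart 𝕜 E G 1)) :=
    α_zero ▸ hα.self_of_nhds.continuousAt
  have tendsto_curve := (tendsto_oneChart_symm 𝕜 E G).comp tendsto_α
  refine ⟨_, tendsto_curve, ?_⟩
  filter_upwards [tendsto_curve.eventually hπ, tendsto_α (ball_mem_nhds _ h.pos),
    h.eventually_apply_integralCurve α_zero hα] with t π_eq α_mem P_eq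
  rw [π_eq, Function.comp_apply, (oneChart 𝕜 E G).right_inv (h.ball_subset α_mem), P_eq]

theorem injective_and_exists_eq_exp [CompleteSpace F] [PreconnectedSpace G] {N : ℕ}
    {B : NilpotentBracket 𝕜 E N} {R : NilpotentRep B F} {P : E → F →L[𝕜] F} {r : ℝ}
    (h : IsChartFlat G R.rep P r) {π : G →* (F →L[𝕜] F)} (hπ_cont : Continuous π)
    (hπ : ∀ᶠ g in 𝓝 (1 : G), π g = P (oneChart 𝕜 E G g)) :
    Function.Injective π ∧ ∀ g, ∃ x, π g = NormedSpace.exp (R.rep x) := by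
  have : IsTopologicalGroup G := topologicalGroup_of_lieGroup 𝓘(𝕜, E) ∞
  have : T1Space G := ChartedSpace.t1Space E G
  have log_injective := h.logLocallyInjective hπ
  obtain ⟨q, q_zero, hq⟩ := h.exists_localInverse_log hπ
  have q_exp := log_injective.eventually_apply_eq_exp hπ_cont R.log_exp q_zero hq
    (h.exists_oneParameterSubgroup hπ)
  obtain ⟨φ, continuous_φ, φ_zero, φ_exp⟩ :=
    log_injective.exists_continuous_exp q_zero (hq.mono fun _ h => h.1) q_exp
  have apply_log := log_injective.apply_log_eq_self hπ_cont R.log.continuous R.log_exp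
    continuous_φ φ_zero φ_exp
  exact ⟨(Function.LeftInverse.injective apply_log).of_comp,
    fun g => ⟨R.log (π g), by rw [← φ_exp, apply_log]⟩⟩

end IsChartFlat

end LocalExponential

theorem exp_sub_one_pow_eq_zero (K : Type*) {A : Type*} [Field K] [CharZero K] [Ring A]
    [TopologicalSpace A] [IsTopologicalRing A] [Algebra K A] {a : A} {n : ℕ}
    (ha : a ^ (n + 1) = 0) : (NormedSpace.exp a - 1) ^ (n + 1) = 0 := by
  let s : A := ∑ k ∈ Finset.range n, ((k + 1).factorial : K)⁻¹ • a ^ k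
  have exp_sub_one : NormedSpace.exp a - 1 = a * s := by
    rw [exp_eq_sum_of_pow_eq_zero K ha, Finset.sum_range_succ', Finset.mul_sum]
    simp [pow_succ']
  have commute : Commute a s := Commute.sum_right _ _ _ fun k _ =>
    ((Commute.refl a).pow_right k).smul_right _
  rw [exp_sub_one, commute.mul_pow, ha, zero_mul]

/-- The bracket of a normed Lie algebra as a bounded bilinear map. -/
noncomputable def lieCLM (𝕜 L : Type*) [RCLike 𝕜] [NormedLieRing L] [NormedLieAlgebra 𝕜 L] :
    L →L[𝕜] L →L[𝕜] L :=
  LinearMap.mkContinuous₂ (LieModule.toEnd 𝕜 L L : L →ₗ[𝕜] L →ₗ[𝕜] L)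
    (NormedLieRing.exists_norm_lie_le (L := L)).choose
    (NormedLieRing.exists_norm_lie_le (L := L)).choose_spec

theorem exists_injective_rep_pow_eq_zero {𝕜 : Type u} [RCLike 𝕜] {N : ℕ} (L : Type v)
    [NormedLieRing L] [NormedLieAlgebra 𝕜 L]
    (hN : LieModule.lowerCentralSeries 𝕜 L L N = ⊥) :
    ∃ (F : Type (max u v)) (_ : NormedAddCommGroup F) (_ : NormedSpace 𝕜 F)
      (_ : CompleteSpace F) (ρ : L →L[𝕜] (F →L[𝕜] F)),
      (∀ x y : L, ρ ⁅x, y⁆ = ρ x * ρ y - ρ y * ρ x) ∧ Function.Injective ρ ∧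
      ∀ x : L, ρ x ^ (N + 1) = 0 := by
  let B : NilpotentBracket 𝕜 L N :=
    .ofLieAlgebra (LinearEquiv.refl 𝕜 L) (lieCLM 𝕜 L) (fun _ _ => rfl) hN
  -- `B.RepSpace V` inherits completeness from `V`, so `V` cannot be `L` itself.
  let V := ULift.{u} (UniformSpace.Completion L)
  let ι : L →L[𝕜] V :=
    (ContinuousLinearEquiv.ulift (R₁ := 𝕜)).symm.toContinuousLinearMap.comp
      (UniformSpace.Completion.toComplL (𝕜 := 𝕜) (E := L))
  have ι_injective : Function.Injective ι :=
    ULift.up_injective.comp (UniformSpace.Completion.coe_injective L)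
  exact ⟨B.RepSpace V, inferInstance, inferInstance, inferInstance, B.rep V, B.rep_br,
    B.rep_injective V ι_injective, B.rep_pow⟩

theorem exists_injective_monoidHom_sub_one_pow_eq_zero {𝕜 : Type u} [RCLike 𝕜] {N : ℕ}
    (E : Type v) [NormedAddCommGroup E] [NormedSpace 𝕜 E] [CompleteSpace E]
    (G : Type w) [TopologicalSpace G] [ChartedSpace E G] [Group G] [LieGroup 𝓘(𝕜, E) ∞ G]
    [SimplyConnectedSpace G]
    (hN : LieModule.lowerCentralSeries 𝕜 (GroupLieAlgebra 𝓘(𝕜, E) G)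
      (GroupLieAlgebra 𝓘(𝕜, E) G) N = ⊥) :
    ∃ (F : Type (max u v)) (_ : NormedAddCommGroup F) (_ : NormedSpace 𝕜 F)
      (_ : CompleteSpace F) (ρ : G →* (F →L[𝕜] F)),
      Function.Injective ρ ∧ Continuous ρ ∧ ∀ x : G, (ρ x - 1) ^ (N + 1) = 0 := by
  let B : NilpotentBracket 𝕜 E N :=
    .ofLieAlgebra (chartLieEquiv 𝕜 E G) (chartBr 𝕜 E G) chartLieEquiv_chartBr hN
  let R := B.nilpotentRep (V := ULift.{u} E) ContinuousLinearEquiv.ulift.symm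
  obtain ⟨P, r, isChartFlat⟩ := R.exists_isChartFlat (G := G) rfl
  obtain ⟨π, continuous_π, π_eq⟩ := isChartFlat.exists_monoidHom
  obtain ⟨injective_π, π_eq_exp⟩ := isChartFlat.injective_and_exists_eq_exp continuous_π π_eq
  refine ⟨B.RepSpace (ULift.{u} E), inferInstance, inferInstance, inferInstance, π, injective_π,
    continuous_π, fun g => ?_⟩
  obtain ⟨x, hx⟩ := π_eq_exp g
  rw [hx]
  exact exp_sub_one_pow_eq_zero 𝕜 (R.rep_pow x)

theorem corollary2p14_general {𝕜 : Type u} [RCLike 𝕜] {N m : ℕ} (hm : N < m) :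
    (∀ (E : Type v) [NormedAddCommGroup E] [NormedSpace 𝕜 E] [CompleteSpace E]
      (G : Type w) [TopologicalSpace G] [ChartedSpace E G] [Group G] [LieGroup 𝓘(𝕜, E) ∞ G]
      [SimplyConnectedSpace G],
      LieModule.lowerCentralSeries 𝕜 (GroupLieAlgebra 𝓘(𝕜, E) G)
        (GroupLieAlgebra 𝓘(𝕜, E) G) N = ⊥ →
      ∃ (F : Type (max u v)) (_ : NormedAddCommGroup F) (_ : NormedSpace 𝕜 F)
        (_ : CompleteSpace F) (ρ : G →* (F →L[𝕜] F)),
        Function.Injective ρ ∧ Continuous ρ ∧ ∀ x : G, (ρ x - 1) ^ m = 0) ∧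
    (∀ (L : Type v) [NormedLieRing L] [NormedLieAlgebra 𝕜 L],
      LieModule.lowerCentralSeries 𝕜 L L N = ⊥ →
      ∃ (F : Type (max u v)) (_ : NormedAddCommGroup F) (_ : NormedSpace 𝕜 F)
        (_ : CompleteSpace F) (ρ : L →L[𝕜] (F →L[𝕜] F)),
        (∀ x y : L, ρ ⁅x, y⁆ = ρ x * ρ y - ρ y * ρ x) ∧ Function.Injective ρ ∧
        ∀ x : L, (ρ x) ^ m = 0) := by
  refine ⟨fun E _ _ _ G _ _ _ _ _ hN => ?_, fun L _ _ hN => ?_⟩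
  · obtain ⟨F, _, _, _, ρ, injective_ρ, continuous_ρ, hρ⟩ :=
      exists_injective_monoidHom_sub_one_pow_eq_zero E G hN
    exact ⟨F, _, _, ‹_›, ρ, injective_ρ, continuous_ρ, fun x => pow_eq_zero_of_le hm (hρ x)⟩
  · obtain ⟨F, _, _, _, ρ, ρ_lie, injective_ρ, hρ⟩ := exists_injective_rep_pow_eq_zero L hN
    exact ⟨F, _, _, ‹_›, ρ, ρ_lie, injective_ρ, fun x => pow_eq_zero_of_le hm (hρ x)⟩

theorem corollary2p14 {𝕜 : Type u} [RCLike 𝕜] (N : ℕ) :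
    -- Banach-Lie groups (`SimplyConnectedSpace` contains path connectedness)
    (∀ (E : Type v) [NormedAddCommGroup E] [NormedSpace 𝕜 E] [CompleteSpace E]
      (G : Type w) [TopologicalSpace G] [ChartedSpace E G] [Group G] [LieGroup 𝓘(𝕜, E) ∞ G]
      [SimplyConnectedSpace G],
      LieModule.lowerCentralSeries 𝕜 (GroupLieAlgebra 𝓘(𝕜, E) G)
        (GroupLieAlgebra 𝓘(𝕜, E) G) N = ⊥ →
      ∃ (F : Type (max u v)) (_ : NormedAddCommGroup F) (_ : NormedSpace 𝕜 F)
        (_ : CompleteSpace F) (ρ : G →* (F →L[𝕜] F)),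
        Function.Injective ρ ∧ Continuous ρ ∧
        ∀ x : G, (ρ x - 1) ^ (2 ^ (N - 1) * N + 1) = 0) ∧
    -- Banach-Lie algebras
    (∀ (L : Type v) [NormedLieRing L] [NormedLieAlgebra 𝕜 L] [CompleteSpace L],
      LieModule.lowerCentralSeries 𝕜 L L N = ⊥ →
      ∃ (F : Type (max u v)) (_ : NormedAddCommGroup F) (_ : NormedSpace 𝕜 F)
        (_ : CompleteSpace F) (ρ : L →L[𝕜] (F →L[𝕜] F)),
        (∀ x y : L, ρ ⁅x, y⁆ = ρ x * ρ y - ρ y * ρ x) ∧ Function.Injective ρ ∧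
        ∀ x : L, (ρ x) ^ (2 ^ (N - 1) * N + 1) = 0) := by
  have lt_exponent : N < 2 ^ (N - 1) * N + 1 :=
    Nat.lt_succ_of_le (Nat.le_mul_of_pos_left N (by positivity))
  exact ⟨(corollary2p14_general lt_exponent).1, fun L _ _ _ =>
    (corollary2p14_general.{u, v, w} lt_exponent).2 L⟩
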